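/- Let $K$ be a field that is complete with respect to a discrete valuation, normalized as $v:K^*\twoheadrightarrow\mathbb{Z}$, with valuation ring $R$ and algebraically closed residue field of characteristic different from $2$ and $3$. Let $E/K$ be an elliptic curve with additive, potentially multiplicative reduction, given by a minimal Weierstrass equation with coordinates $x,y$, coefficients $a_i$ and discriminant $\Delta$, and let $j_E$ be its $j$-invariant. Then $E$ has reduction type $I_M^*$, where $M=v(\Delta)-6=v(j_E^{-1})\ge 1$. The special fibre of the minimal regular model of $E$ over $R$ consists of four components of multiplicity one, called $\mathbf 0,\alpha,\beta,\beta'$, and a chain of $M+1$ components of multiplicity two; $\mathbf 0$ and $\alpha$ meet the first component of the chain and $\beta,\beta'$ meet the last one, and $\mathbf 0$ is the component hit by the zero point. Every point of $E(K)$ hits exactly one of $\mathbf 0,\alpha,\beta,\beta'$. These components are understood in the explicit form in which Tate's algorithm gives them. Let $E_0(K)$ be the set of points that hit $\mathbf 0$, i.e. that have nonsingular reduction, and for $\nu\ge 1$ let $E_\nu(K)=\{0\}\cup\{P : v(x(P)^{-1})\ge 2\nu\}$. There is a unique function (the canonical local height) $\hat\lambda_v:E(K)\smallsetminus\{0\}\to\mathbb{R}$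 such that (i) $\hat\lambda_v$ is continuous, and bounded on the complement of every $v$-adic neighbourhood of $0$; (ii) $\lim_{P\to 0}\bigl[\hat\lambda_v(P)+\tfrac12 v(x(P))\bigr]$ exists; (iii) for all $P\in E(K)$ with $2P\ne 0$, $$\hat\lambda_v(2P)=4\hat\lambda_v(P)+\tfrac14 v\!\left(\frac{(2y(P)+a_1x(P)+a_3)^4}{\Delta}\right).$$ For $P\in E(K)\smallsetminus\{0\}$ it is given by $$\hat\lambda_v(P)=\begin{cases}\dfrac{v(\Delta)}{12}+\nu=\dfrac{v(j_E^{-1})}{12}+\dfrac12+\nu & \text{if } P\in E_\nu(K)\smallsetminus E_{\nu+1}(K),\ \nu\ge 0,\\[2mm] \dfrac{v(j_E^{-1})}{12}=\dfrac12\mathsf{B}_2(0)\,v(j_E^{-1}) & \text{if } P \text{ hits the } \alpha\text{-component},\\[2mm] -\dfrac{v(j_E^{-1})}{24}=\dfrac12\mathsf{B}_2(\tfrac12)\,v(j_E^{-1}) & \text{if } P \text{ hits the } \beta\text{- or } \beta'\text{-component},\end{cases}$$ where $\mathsf{B}_2$ is the function of period $1$ on $\mathbb{R}$ with $\mathsf{B}_2(t)=t^2-t+\tfrac16$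 for $0\le t\le 1$. -/

import Mathlib

universe u

noncomputable section

namespace WeierstrassCurve

open IsLocalRing

section Basic

variable (R : Type*) [CommRing R] [IsDomain R] [IsDiscreteValuationRing R]
  {K : Type u} [Field K] [Algebra R K] [IsFractionRing R K]

/-- The multiplicative valuation `K → ℤᵐ⁰` attached to the maximal ideal of `R`. -/
abbrev mulVal : Valuation K (WithZero (Multiplicative ℤ)) :=
  (IsDiscreteValuationRing.maximalIdeal R).valuation K

/-- The normalized additive valuation `v : Kˣ ↠ ℤ` (with the unused value `0` at `0`). -/
def ord (z : K) : ℤ := -WithZero.log (mulVal R z)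

/-- The `x`-coordinate of an affine point (value `0`, unused, at the point at infinity). -/
def xCoord {W : WeierstrassCurve K} : W.toAffine.Point → K
  | .zero => 0
  | .some x _ _ => x

/-- The `y`-coordinate of an affine point (value `0`, unused, at the point at infinity). -/
def yCoord {W : WeierstrassCurve K} : W.toAffine.Point → K
  | .zero => 0
  | .some _ y _ => y

/-- `W` has potentially multiplicative reduction: over some finite extension `L` of `K`, in which
the integral closure `S` of `R` is a discrete valuation ring with fraction field `L`, some
Weierstrass equation of the curve is minimal with multiplicative reduction. -/
def HasPotentiallyMultiplicativeReduction (W : WeierstrassCurve K) : Prop :=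
  ∃ (L : Type u) (_ : Field L) (_ : Algebra K L) (_ : Algebra R L) (_ : IsScalarTower R K L)
    (_ : FiniteDimensional K L) (_ : IsDiscreteValuationRing (integralClosure R L))
    (_ : IsFractionRing (integralClosure R L) L) (C : VariableChange L),
    (C • W.map (algebraMap K L)).HasMultiplicativeReduction (integralClosure R L)

end Basic

section LocalHeight

variable (R : Type*) [CommRing R] [IsDomain R] [IsDiscreteValuationRing R]
  {K : Type u} [Field K] [DecidableEq K] [Algebra R K] [IsFractionRing R K]

/-- `lam : E(K) ∖ {0} → ℝ` is the (Néron–Tate) canonical local height. The topology on `E(K) ∖ {0}`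
is the `v`-adic one, induced by the affine coordinates `(x, y)`; the sets `{0} ∪ {v(x) < -N}` form
a neighbourhood basis of `0`. Recall that `mulVal z ≤ exp (-N)` means `v(z) ≥ N`. -/
structure IsCanonicalLocalHeight (W : WeierstrassCurve K)
    (lam : {P : W.toAffine.Point // P ≠ 0} → ℝ) : Prop where
  /-- `lam` is continuous. -/
  continuous : ∀ P, ∀ ε : ℝ, 0 < ε → ∃ N : ℤ, ∀ Q : {P : W.toAffine.Point // P ≠ 0},
    mulVal R (xCoord Q.1 - xCoord P.1) ≤ WithZero.exp (-N) →
    mulVal R (yCoord Q.1 - yCoord P.1) ≤ WithZero.exp (-N) → |lam Q - lam P| < ε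
  /-- `lam` is bounded on the complement of every neighbourhood of `0`. -/
  bounded : ∀ N : ℤ, ∃ B : ℝ, ∀ P : {P : W.toAffine.Point // P ≠ 0},
    mulVal R (xCoord P.1) ≤ WithZero.exp N → |lam P| ≤ B
  /-- The limit of `lam P + v(x(P)) / 2` as `P → 0` exists. -/
  limit : ∃ l : ℝ, ∀ ε : ℝ, 0 < ε → ∃ N : ℤ, ∀ P : {P : W.toAffine.Point // P ≠ 0},
    WithZero.exp N < mulVal R (xCoord P.1) → |lam P + (ord R (xCoord P.1) : ℝ) / 2 - l| < ε
  /-- The normalized duplication formula. -/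
  duplication : ∀ (P : {P : W.toAffine.Point // P ≠ 0}) (h : 2 • P.1 ≠ 0),
    lam ⟨2 • P.1, h⟩ = 4 * lam P +
      (1 / 4) * (ord R ((2 * yCoord P.1 + W.a₁ * xCoord P.1 + W.a₃) ^ 4 / W.Δ) : ℝ)

/-- The periodic second Bernoulli polynomial `B₂(t) = t² - t + 1/6` for `0 ≤ t ≤ 1`, extended to
`ℝ` with period `1`. -/
def periodicB₂ (t : ℝ) : ℝ := Int.fract t ^ 2 - Int.fract t + 1 / 6

end LocalHeight

section Components

variable (R : Type*) [CommRing R] [IsDomain R] [IsDiscreteValuationRing R]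
  {K : Type u} [Field K] [Algebra R K] [IsFractionRing R K]

/-- A point of a minimal Weierstrass equation hits the `0`-component of the special fibre, i.e. it
reduces to a nonsingular point of the reduced curve (points with non-integral coordinates, and the
point at infinity, reduce to the point at infinity, which is nonsingular). -/
def HitsZero (W : WeierstrassCurve K) [W.IsMinimal R] : W.toAffine.Point → Prop
  | .zero => True
  | .some x y _ => ∀ a b : R, algebraMap R K a = x → algebraMap R K b = y →
      (W.reduction R).toAffine.Nonsingular (residue R a) (residue R b)

/-- The formal group filtration on the points of a minimal Weierstrass equation: `E₀(K)` consists of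
the points that hit the `0`-component, and, for `ν ≥ 1`, `E_ν(K)` consists of `0` and the points
with `v(x⁻¹) ≥ 2ν`. -/
def formalFiltration (W : WeierstrassCurve K) [W.IsMinimal R] : ℕ → Set W.toAffine.Point
  | 0 => {P | HitsZero R W P}
  | n + 1 => {P | P = 0 ∨ WithZero.exp (2 * ((n : ℤ) + 1)) ≤ mulVal R (xCoord P)}

/-- The integral Weierstrass equation `A`, with uniformizer `ϖ`, is one at which Tate's algorithm
stops with Kodaira type `I_M^*`, `M ≥ 1`. Write `a_{i,n} = a_i / ϖⁿ`. The cubic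
`T³ + a_{2,1} T² + a_{4,2} T + a_{6,3}` has modulo `ϖ` the double root `0` and the simple root
`-a_{2,1}`, and the subprocedure of the algorithm has been run to its end:
* if `M = 2 m + 1`, then `Y² + a_{3,m+2} Y - a_{6,2m+4}` has distinct roots modulo `ϖ`;
* if `M = 2 m + 2`, then `a_{2,1} X² + a_{4,m+3} X + a_{6,2m+5}` has distinct roots modulo `ϖ`. -/
def IsIStarEquation {R : Type*} [CommRing R] (ϖ : R) (A : WeierstrassCurve R) (M : ℕ) : Prop :=
  ϖ ∣ A.a₁ ∧ ϖ ∣ A.a₂ ∧ ¬ ϖ ^ 2 ∣ A.a₂ ∧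
  ((∃ (m : ℕ) (a b : R), M = 2 * m + 1 ∧ A.a₃ = ϖ ^ (m + 2) * a ∧ ϖ ^ (m + 3) ∣ A.a₄ ∧
      A.a₆ = ϖ ^ (2 * m + 4) * b ∧ ¬ ϖ ∣ a ^ 2 + 4 * b) ∨
    (∃ (m : ℕ) (c a b : R), M = 2 * m + 2 ∧ ϖ ^ (m + 3) ∣ A.a₃ ∧ A.a₂ = ϖ * c ∧
      A.a₄ = ϖ ^ (m + 3) * a ∧ A.a₆ = ϖ ^ (2 * m + 5) * b ∧ ¬ ϖ ∣ a ^ 2 - 4 * c * b))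

/-- A model over `R` of the curve `W` over `K` at which Tate's algorithm stops with type `I_M^*`:
a uniformizer `ϖ` and a change of variables `C` such that `C • W` is such an equation `A`. -/
structure IStarModel (W : WeierstrassCurve K) (M : ℕ) where
  /-- A uniformizer. -/
  ϖ : R
  irreducible : Irreducible ϖ
  /-- The change of variables. -/
  C : VariableChange K
  /-- The resulting integral equation. -/
  A : WeierstrassCurve R
  smul_eq : C • W = A.map (algebraMap R K)
  isIStar : IsIStarEquation ϖ A M

/-- `W` has Kodaira type `I_M^*` (`M ≥ 1`), as determined by Tate's algorithm. -/
def HasKodairaTypeIStar (W : WeierstrassCurve K) (M : ℕ) : Prop := Nonempty (IStarModel R W M)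

/-- The point `P` of `W` has affine coordinates `(X, Y)` on the equation `C • W`, where
`x = u² X + r` and `y = u³ Y + u² s X + t`. -/
def HasCoordinates {W : WeierstrassCurve K} (C : VariableChange K) (X Y : K) :
    W.toAffine.Point → Prop
  | .zero => False
  | .some x y _ => x = C.u ^ 2 * X + C.r ∧ y = C.u ^ 3 * Y + C.u ^ 2 * C.s * X + C.t

variable {R}

/-- `P` hits the `α`-component: the multiplicity-one component other than the `0`-component that
meets the same multiplicity-two component as the `0`-component does. It is the component that
arises above the simple root `-a_{2,1}` of Tate's cubic. Away from its intersection point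
with the rest of the special fibre it is the special fibre of the smooth affine chart of the
minimal regular model with coordinates `p, q`, where `X = -a₂ + ϖ² p` and `Y = ϖ² q`: the
equation divided by `ϖ⁴` reads modulo `ϖ` as `q² + (a_{3,2} - a_{1,1} a_{2,1}) q =
a_{2,1}² p - a_{4,3} a_{2,1} + a_{6,4}`, an affine line. So `P` hits this component if and only if
its coordinates `p, q` are integral. -/
def IStarModel.HitsAlpha {W : WeierstrassCurve K} {M : ℕ} (T : IStarModel R W M)
    (P : W.toAffine.Point) : Prop :=
  ∃ p q : R, HasCoordinates T.C (algebraMap R K (-T.A.a₂ + T.ϖ ^ 2 * p))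
    (algebraMap R K (T.ϖ ^ 2 * q)) P

/-- `P` hits the `β`- or the `β'`-component, the two multiplicity-one components at the
other end of the chain of multiplicity-two components. Away from their intersection points with
the rest of the special fibre they are the two lines that make up the special fibre of the smooth
affine chart of the minimal regular model with coordinates `p, q`, where
* `X = ϖ^(m+2) p` and `Y = ϖ^(m+2) q` if `M = 2 m + 1`: the equation divided by `ϖ^(2m+4)` reads
  modulo `ϖ` as `q² + a_{3,m+2} q - a_{6,2m+4} = 0`, two disjoint lines;
* `X = ϖ^(m+2) p` and `Y = ϖ^(m+3) q` if `M = 2 m + 2`: the equation divided by `ϖ^(2m+5)` reads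
  modulo `ϖ` as `0 = a_{2,1} p² + a_{4,m+3} p + a_{6,2m+5}`, two disjoint lines.
So `P` hits one of these components if and only if its coordinates `p, q` are integral. -/
def IStarModel.HitsBeta {W : WeierstrassCurve K} {M : ℕ} (T : IStarModel R W M)
    (P : W.toAffine.Point) : Prop :=
  ∃ (m : ℕ) (p q : R),
    (M = 2 * m + 1 ∧ HasCoordinates T.C (algebraMap R K (T.ϖ ^ (m + 2) * p))
      (algebraMap R K (T.ϖ ^ (m + 2) * q)) P) ∨
    (M = 2 * m + 2 ∧ HasCoordinates T.C (algebraMap R K (T.ϖ ^ (m + 2) * p))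
      (algebraMap R K (T.ϖ ^ (m + 3) * q)) P)

end Components

end WeierstrassCurve

end

/-!
The proof is elementary: the special fibre enters only through congruences on one coordinate.

Completing the square in an equation of type `I_M^*` and dividing the coordinate `X` by the
uniformizer `ϖ` leads to the twisted equation `Y² = ϖ³ g(S)` with a cubic
`g = S³ + c₂ S² + c₄ S + c₆` that modulo `ϖ` has the simple root `-c₂` and the double root `0`;
precisely, `v(c₂) = 0`, `2 v(c₄) ≥ M`, `v(c₆) ≥ M` and `v(c₄² - 4 c₂ c₆) = M` (`IsStarCubic`,
`IStarModel.isStarCubic`). A point of the curve therefore has `g(S) = 0` or `v(g(S))` odd. This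
parity leaves three possibilities: `S` is not integral, `S` reduces to the simple root, or `S`
reduces to the double root and `2 v(S) ≥ M`. They are the conditions to hit the `0`-component, the
`α`-component, and the `β`- or `β'`-component (`IStarModel.hitsZero_iff`,
`IStarModel.hitsAlpha_iff`, `IStarModel.hitsBeta_iff`).

The height is defined in terms of `S` by the three formulas of the theorem (`starHeight`). All the
conditions on a canonical local height are then clear, except for the duplication formula. In terms
of `S` duplication reads `S(2P) = (S⁴ - 2 c₄ S² - 8 c₆ S + c₄² - 4 c₂ c₆) / (4 g(S))`, and the
valuations of numerator and denominator are determined in each case. In the third case, when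
`v(g(S)) = M`, parity shows once more that `2P` hits the `α`-component
(`IsStarCubic.starHeight_duplication`).

Uniqueness (`IsCanonicalLocalHeight.unique`) uses completeness: `0` and the points of order two are
limits of other points whose doubles tend to `0`, since `1 + ϖ z` is always a square. So the
difference `d` of two canonical local heights, which is bounded and satisfies `d(2P) = 4 d(P)`,
vanishes at the points of order two, and `|d| ≤ B` implies `|d| ≤ B / 4`.

A model of type `I_M^*` exists because minimality together with `v(j) < 0` forces `v(c₄) = 2`,
`v(c₆) = 3` and `v(Δ) = M + 6` for the invariants of the curve
(`exists_valuations_of_additive`), and moving the origin to an approximate node makes the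
coefficients explicit multiples of `c₆ / c₄`, `Δ / c₄²` and `c₆ Δ / c₄³`
(`hasKodairaTypeIStar_of_veq`). Conversely every model of type `I_M^*` has discriminant of valuation
`M + 6`, so it differs from the given minimal equation by an integral change of variables, and the
results above apply to it (`IStarModel.veq_u`, `IStarModel.vge_rst`).
-/

noncomputable section

namespace WeierstrassCurve

open IsLocalRing

/-! ### Valuation estimates -/

section Val

variable (R : Type*) [CommRing R] [IsDomain R] [IsDiscreteValuationRing R]
  {K : Type u} [Field K] [Algebra R K] [IsFractionRing R K]

/-- `v(z) ≥ n`, where `0` has infinite valuation. -/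
def VGe (n : ℤ) (z : K) : Prop := mulVal R z ≤ WithZero.exp (-n)

/-- `v(z) = n`; in particular `z ≠ 0`. -/
def VEq (n : ℤ) (z : K) : Prop := mulVal R z = WithZero.exp (-n)

variable {R} {n m k : ℤ} {a b : K}

lemma VGe.mono (h : VGe R n a) (hm : m ≤ n) : VGe R m a :=
  h.trans (WithZero.exp_le_exp.2 (by omega))

lemma vge_zero : VGe R n (0 : K) := by simp [VGe]

lemma VGe.neg (h : VGe R n a) : VGe R n (-a) := by rwa [VGe, Valuation.map_neg]

lemma VGe.add (ha : VGe R n a) (hb : VGe R n b) : VGe R n (a + b) :=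
  (Valuation.map_add _ _ _).trans (max_le ha hb)

lemma VGe.sub (ha : VGe R n a) (hb : VGe R n b) : VGe R n (a - b) :=
  (Valuation.map_sub _ _ _).trans (max_le ha hb)

lemma VGe.mul (ha : VGe R n a) (hb : VGe R m b) (hk : k ≤ n + m) : VGe R k (a * b) := by
  refine VGe.mono ?_ hk
  rw [VGe, map_mul, neg_add, WithZero.exp_add]
  exact mul_le_mul' ha hb

lemma VGe.pow (ha : VGe R n a) (i : ℕ) (hk : k ≤ i * n) : VGe R k (a ^ i) := by
  refine VGe.mono ?_ hk
  rw [VGe, map_pow, show -((i : ℤ) * n) = i • (-n) by simp, WithZero.exp_nsmul]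
  exact pow_le_pow_left' ha i

lemma VEq.vge (h : VEq R n a) (hm : m ≤ n) : VGe R m a := VGe.mono (le_of_eq h) hm

lemma VEq.ne_zero (h : VEq R n a) : a ≠ 0 := by
  rintro rfl
  rw [VEq, map_zero] at h
  exact WithZero.exp_ne_zero h.symm

lemma exists_veq (ha : a ≠ 0) : ∃ n, VEq R n a :=
  ⟨-WithZero.log (mulVal R a), by
    rw [VEq, neg_neg, WithZero.exp_log ((Valuation.ne_zero_iff _).2 ha)]⟩

lemma VEq.le (h : VEq R n a) (h' : VGe R m a) : m ≤ n := by
  rw [VGe, h, WithZero.exp_le_exp] at h'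
  omega

lemma VEq.unique (h : VEq R n a) (h' : VEq R m a) : n = m :=
  le_antisymm (h'.le (h.vge le_rfl)) (h.le (h'.vge le_rfl))

lemma VEq.ord (h : VEq R n a) : ord R a = n := by
  rw [WeierstrassCurve.ord, h, WithZero.log_exp, neg_neg]

lemma VEq.neg (h : VEq R n a) : VEq R n (-a) := by rwa [VEq, Valuation.map_neg]

lemma VEq.mul (ha : VEq R n a) (hb : VEq R m b) (hk : k = n + m) : VEq R k (a * b) := by
  rw [VEq, map_mul, ha, hb, hk, neg_add, WithZero.exp_add]

lemma VEq.pow (ha : VEq R n a) (i : ℕ) (hk : k = i * n) : VEq R k (a ^ i) := by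
  rw [VEq, map_pow, ha, hk, show -((i : ℤ) * n) = i • (-n) by simp, WithZero.exp_nsmul]

lemma VEq.inv (ha : VEq R n a) (hk : k = -n) : VEq R k a⁻¹ := by
  rw [VEq, map_inv₀, ha, hk, ← WithZero.exp_neg]

lemma VEq.div (ha : VEq R n a) (hb : VEq R m b) (hk : k = n - m) : VEq R k (a / b) := by
  rw [div_eq_mul_inv]
  exact ha.mul (hb.inv rfl) (by omega)

lemma VGe.div (ha : VGe R n a) (hb : VEq R m b) (hk : k ≤ n - m) : VGe R k (a / b) := by
  rw [div_eq_mul_inv]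
  exact ha.mul ((hb.inv rfl).vge le_rfl) (by omega)

lemma VEq.add (ha : VEq R n a) (hb : VGe R (n + 1) b) : VEq R n (a + b) := by
  rw [VEq, Valuation.map_add_eq_of_lt_left]
  · exact ha
  · rw [ha]
    exact lt_of_le_of_lt hb (WithZero.exp_lt_exp.2 (by omega))

lemma VEq.congr (ha : VEq R n a) (hb : VGe R (n + 1) (b - a)) : VEq R n b := by
  have := ha.add hb
  rwa [add_sub_cancel] at this

/-- Every element has either large valuation or a definite smaller one. -/
lemma vge_or_veq (n : ℤ) (a : K) : VGe R n a ∨ ∃ m < n, VEq R m a := by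
  by_cases ha : a = 0
  · exact .inl (ha ▸ vge_zero)
  · obtain ⟨m, hm⟩ := exists_veq (R := R) ha
    rcases le_or_gt n m with h | h
    · exact .inl (hm.vge h)
    · exact .inr ⟨m, h, hm⟩

lemma VGe.of_pow (i : ℕ) (h : VGe R k (a ^ i)) (hk : i * (n - 1) < k) : VGe R n a := by
  rcases vge_or_veq (R := R) n a with h' | ⟨m, hm, h'⟩
  · exact h'
  · have h1 := (h'.pow i rfl).le h
    have : (i : ℤ) * m ≤ i * (n - 1) := by
      apply mul_le_mul_of_nonneg_left <;> omega
    omega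

lemma VEq.of_mul (h : VEq R k (a * b)) (ha : VEq R m a) (hn : n = k - m) : VEq R n b := by
  have h1 := h.div ha hn
  rwa [mul_div_cancel_left₀ _ ha.ne_zero] at h1

lemma vge_algebraMap (r : R) : VGe R 0 (algebraMap R K r) := by
  simpa [VGe] using IsDedekindDomain.HeightOneSpectrum.valuation_le_one _ r

lemma VGe.exists_eq (h : VGe R 0 a) : ∃ r : R, algebraMap R K r = a :=
  IsDiscreteValuationRing.exists_lift_of_le_one (by simpa [VGe] using h)

lemma vge_natCast (i : ℕ) : VGe R 0 (i : K) := by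
  simpa using vge_algebraMap (R := R) (K := K) i

lemma vge_ofNat (i : ℕ) [i.AtLeastTwo] : VGe R 0 (OfNat.ofNat i : K) := vge_natCast i

lemma vge_one_algebraMap {r : R} : VGe R 1 (algebraMap R K r) ↔ residue R r = 0 := by
  rw [residue_eq_zero_iff]
  refine Iff.trans ?_ (IsDedekindDomain.HeightOneSpectrum.valuation_lt_one_iff_mem (K := K)
    (IsDiscreteValuationRing.maximalIdeal R) r)
  rw [VGe]
  constructor
  · intro h
    refine lt_of_le_of_lt h ?_
    rw [← WithZero.exp_zero, WithZero.exp_lt_exp]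
    omega
  · intro h
    rcases vge_or_veq (R := R) 1 (algebraMap R K r) with h' | ⟨m, hm, h'⟩
    · exact h'
    · rw [h', ← WithZero.exp_zero, WithZero.exp_lt_exp] at h
      omega

lemma veq_zero_algebraMap {r : R} : VEq R 0 (algebraMap R K r) ↔ residue R r ≠ 0 := by
  rw [Ne, ← vge_one_algebraMap (K := K)]
  constructor
  · intro h h'
    have := h.le h'
    omega
  · intro h
    rcases vge_or_veq (R := R) 1 (algebraMap R K r) with h' | ⟨m, hm, h'⟩
    · exact absurd h' h
    · have := h'.le (vge_algebraMap r)
      obtain rfl : m = 0 := by omega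
      exact h'

lemma veq_one : VEq R 0 (1 : K) := by simp [VEq]

lemma veq_uniformizer {ϖ : R} (h : Irreducible ϖ) : VEq R 1 (algebraMap R K ϖ) := by
  have h1 : VGe R 1 (algebraMap R K ϖ) :=
    vge_one_algebraMap.2 ((residue_eq_zero_iff _).2 h.not_isUnit)
  obtain ⟨z, hz⟩ := IsDedekindDomain.HeightOneSpectrum.valuation_exists_uniformizer K
    (IsDiscreteValuationRing.maximalIdeal R)
  have hz : VEq R 1 z := hz
  obtain ⟨n, hn⟩ := exists_veq (R := R) (a := algebraMap R K ϖ)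
    ((map_ne_zero_iff _ (IsFractionRing.injective R K)).2 h.ne_zero)
  obtain ⟨r, rfl⟩ := (hz.vge zero_le_one).exists_eq
  have hr : ϖ ∣ r := by
    rw [← Ideal.mem_span_singleton, ← (IsDiscreteValuationRing.irreducible_iff_uniformizer ϖ).1 h,
      ← residue_eq_zero_iff, ← vge_one_algebraMap (K := K)]
    exact hz.vge le_rfl
  obtain ⟨s, rfl⟩ := hr
  rw [map_mul] at hz
  have h2 := hz.le ((hn.vge le_rfl).mul (vge_algebraMap s) le_rfl)
  have h3 := hn.le h1
  obtain rfl : n = 1 := by omega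
  exact hn

lemma vge_pow_dvd {ϖ : R} (h : Irreducible ϖ) {i : ℕ} {r : R} :
    VGe R i (algebraMap R K r) ↔ ϖ ^ i ∣ r := by
  have hϖ := (veq_uniformizer (K := K) h).pow i (k := i) (by omega)
  constructor
  · intro hr
    obtain ⟨s, hs⟩ := (hr.div hϖ (k := 0) (by omega)).exists_eq
    refine ⟨s, IsFractionRing.injective R K ?_⟩
    rw [map_mul, hs, map_pow, mul_div_cancel₀ _ hϖ.ne_zero]
  · rintro ⟨s, rfl⟩
    rw [map_mul, map_pow]
    exact (hϖ.vge le_rfl).mul (vge_algebraMap s) (by omega)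

lemma vge_of_dvd {ϖ : R} (h : Irreducible ϖ) {i : ℕ} {r : R} (hr : ϖ ^ i ∣ r) (hk : k ≤ i) :
    VGe R k (algebraMap R K r) :=
  ((vge_pow_dvd h).2 hr).mono hk

lemma vge_one_dvd {ϖ : R} (h : Irreducible ϖ) {r : R} :
    VGe R 1 (algebraMap R K r) ↔ ϖ ∣ r := by
  simpa using vge_pow_dvd (K := K) h (i := 1) (r := r)

lemma VGe.exists_mul_pow {ϖ : R} (h : Irreducible ϖ) {i : ℕ} (ha : VGe R i a) :
    ∃ r : R, a = algebraMap R K (ϖ ^ i * r) := by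
  obtain ⟨s, rfl⟩ := (ha.mono (by omega)).exists_eq
  obtain ⟨r, rfl⟩ := (vge_pow_dvd h).1 ha
  exact ⟨r, rfl⟩

lemma veq_two (h2 : (2 : ResidueField R) ≠ 0) : VEq R 0 (2 : K) := by
  have := veq_zero_algebraMap (R := R) (K := K) (r := 2)
  simp only [map_ofNat] at this
  exact this.2 h2

lemma veq_three (h3 : (3 : ResidueField R) ≠ 0) : VEq R 0 (3 : K) := by
  have := veq_zero_algebraMap (R := R) (K := K) (r := 3)
  simp only [map_ofNat] at this
  exact this.2 h3

lemma veq_four (h2 : (2 : ResidueField R) ≠ 0) : VEq R 0 (4 : K) := by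
  rw [show (4 : K) = 2 * 2 by norm_num]
  exact (veq_two h2).mul (veq_two h2) rfl

lemma VGe.of_mul (h : VGe R k (a * b)) (ha : VEq R m a) (hn : n ≤ k - m) : VGe R n b := by
  have h1 := h.div ha hn
  rwa [mul_div_cancel_left₀ _ ha.ne_zero] at h1

end Val

/-! ### The cubic of an equation of type `I_M^*` -/

section Cubic

/-- The cubic `S³ + c₂ S² + c₄ S + c₆`. -/
def cubicEval {K : Type*} [Field K] (c₂ c₄ c₆ S : K) : K := S ^ 3 + c₂ * S ^ 2 + c₄ * S + c₆

/-- The numerator of the duplication formula on `Y² = S³ + c₂ S² + c₄ S + c₆`, whose denominator is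
four times the cubic. -/
def duplicationNumerator {K : Type*} [Field K] (c₂ c₄ c₆ S : K) : K :=
  S ^ 4 - 2 * c₄ * S ^ 2 - 8 * c₆ * S + (c₄ ^ 2 - 4 * c₂ * c₆)

variable (R : Type*) [CommRing R] [IsDomain R] [IsDiscreteValuationRing R]
  {K : Type u} [Field K] [Algebra R K] [IsFractionRing R K]

/-- The cubic `S³ + c₂ S² + c₄ S + c₆` has modulo the maximal ideal the simple root `-c₂` and the
double root `0`, and the two roots above `0` differ by an element whose square has valuation `M`.
This is what is left of an equation of type `I_M^*` after the square has been completed and the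
coordinate divided by a uniformizer. -/
structure IsStarCubic (M : ℤ) (c₂ c₄ c₆ : K) : Prop where
  one_le : 1 ≤ M
  veq_c₂ : VEq R 0 c₂
  vge_c₄ : VGe R M (c₄ ^ 2)
  vge_c₆ : VGe R M c₆
  veq_disc : VEq R M (c₄ ^ 2 - 4 * c₂ * c₆)

open Classical in
/-- The local height in terms of the coordinate `S`: it is `M / 12 - v(S) / 2` where `S` is not
integral (the `0`-component), `M / 12` where `S` reduces to the simple root `-c₂` of the cubic (the
`α`-component), and `-M / 24` elsewhere (the `β`- and `β'`-components). -/
def starHeight (M : ℤ) (c₂ S : K) : ℝ :=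
  if VGe R 0 S then if VGe R 1 (S + c₂) then (M : ℝ) / 12 else -(M : ℝ) / 24
  else (M : ℝ) / 12 - (ord R S : ℝ) / 2

variable {R} {M : ℤ} {c₂ c₄ c₆ S : K}

lemma starHeight_of_veq {n : ℤ} (h : VEq R n S) (hn : n < 0) :
    starHeight R M c₂ S = (M : ℝ) / 12 - n / 2 := by
  rw [starHeight, if_neg (fun h' => by have := h.le h'; omega), h.ord]

lemma starHeight_of_vge_add (h0 : VGe R 0 c₂) (h : VGe R 1 (S + c₂)) :
    starHeight R M c₂ S = (M : ℝ) / 12 := by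
  have : VGe R 0 S := by simpa using (h.mono (m := 0) (by omega)).sub h0
  rw [starHeight, if_pos this, if_pos h]

lemma starHeight_of_vge (h0 : VEq R 0 c₂) (h : VGe R 1 S) :
    starHeight R M c₂ S = -(M : ℝ) / 24 := by
  rw [starHeight, if_pos (h.mono (by omega)), if_neg]
  intro h'
  have := h0.le (m := 1) (by simpa using h'.sub h)
  omega

namespace IsStarCubic

variable (H : IsStarCubic R M c₂ c₄ c₆)
include H

lemma exists_vge_c₄ : ∃ h : ℤ, VGe R h c₄ ∧ M ≤ 2 * h ∧ 2 * h ≤ M + 1 :=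
  ⟨(M + 1) / 2, H.vge_c₄.of_pow 2 (by push_cast; omega), by omega, by omega⟩

lemma veq_cubicEval_of_neg {n : ℤ} (h : VEq R n S) (hn : n < 0) :
    VEq R (3 * n) (cubicEval c₂ c₄ c₆ S) := by
  obtain ⟨h4, hc4, _, _⟩ := H.exists_vge_c₄
  have hM := H.one_le
  refine (((h.pow 3 rfl).add ?_).add ?_).add ?_
  · exact (H.veq_c₂.vge le_rfl).mul ((h.pow 2 rfl).vge le_rfl) (by push_cast; omega)
  · exact hc4.mul (h.vge le_rfl) (by push_cast; omega)
  · exact H.vge_c₆.mono (by push_cast; omega)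

lemma veq_duplicationNumerator_of_neg {n : ℤ} (h : VEq R n S) (hn : n < 0) :
    VEq R (4 * n) (duplicationNumerator c₂ c₄ c₆ S) := by
  obtain ⟨h4, hc4, _, _⟩ := H.exists_vge_c₄
  have hM := H.one_le
  have e : duplicationNumerator c₂ c₄ c₆ S = S ^ 4 + (-(2 * c₄ * S ^ 2) + -(8 * c₆ * S) +
    (c₄ ^ 2 - 4 * c₂ * c₆)) := by rw [duplicationNumerator]; ring
  rw [e]
  refine (h.pow 4 rfl).add ((VGe.add (VGe.neg ?_) (VGe.neg ?_)).add ?_)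
  · exact ((vge_ofNat 2).mul hc4 le_rfl).mul ((h.pow 2 rfl).vge le_rfl) (by push_cast; omega)
  · exact ((vge_ofNat 8).mul H.vge_c₆ le_rfl).mul (h.vge le_rfl) (by push_cast; omega)
  · exact H.veq_disc.vge (by push_cast; omega)

/-- Modulo the maximal ideal the cubic is `S² (S + c₂)`. -/
lemma vge_cubicEval_sub (h : VGe R 0 S) : VGe R 1 (cubicEval c₂ c₄ c₆ S - S ^ 2 * (S + c₂)) := by
  obtain ⟨h4, hc4, _, _⟩ := H.exists_vge_c₄
  have hM := H.one_le
  rw [show cubicEval c₂ c₄ c₆ S - S ^ 2 * (S + c₂) = c₄ * S + c₆ by rw [cubicEval]; ring]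
  exact (hc4.mul h (by omega)).add (H.vge_c₆.mono hM)

/-- At an integral `S` where the cubic vanishes or has odd valuation, it vanishes modulo the maximal
ideal, so `S` reduces to one of its roots. -/
lemma vge_add_or_vge (h : VGe R 0 S) (hodd : ∀ n, VEq R n (cubicEval c₂ c₄ c₆ S) → Odd n) :
    VGe R 1 (S + c₂) ∨ VGe R 1 S := by
  rcases vge_or_veq (R := R) 1 S with h1 | ⟨m, hm, h1⟩
  · exact .inr h1
  left
  have hm' := h1.le h
  obtain rfl : m = 0 := by omega
  have hg : VGe R 1 (cubicEval c₂ c₄ c₆ S) := by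
    rcases vge_or_veq (R := R) 1 (cubicEval c₂ c₄ c₆ S) with h2 | ⟨m, hm, h2⟩
    · exact h2
    · have h3 := h2.le (m := 0) <| by
        rw [← sub_add_cancel (cubicEval c₂ c₄ c₆ S) (S ^ 2 * (S + c₂))]
        exact ((H.vge_cubicEval_sub h).mono (by omega)).add
          ((h.pow 2 le_rfl).mul (h.add (H.veq_c₂.vge le_rfl)) (by norm_num))
      have h4 := hodd m h2
      obtain rfl : m = 0 := by omega
      exact absurd h4 (by decide)
  refine VGe.of_mul (k := 1) (m := 0) (a := S ^ 2) ?_ (h1.pow 2 (by norm_num)) (by norm_num)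
  simpa using hg.sub (H.vge_cubicEval_sub h)

lemma veq_of_vge_add (h : VGe R 1 (S + c₂)) : VEq R 0 S :=
  H.veq_c₂.neg.congr (by simpa using h)

lemma vge_cubicEval_of_vge_add (h : VGe R 1 (S + c₂)) : VGe R 1 (cubicEval c₂ c₄ c₆ S) := by
  have hS := (H.veq_of_vge_add h).vge le_rfl
  rw [← sub_add_cancel (cubicEval c₂ c₄ c₆ S) (S ^ 2 * (S + c₂))]
  exact (H.vge_cubicEval_sub hS).add ((hS.pow 2 le_rfl).mul h (by norm_num))

lemma veq_duplicationNumerator_of_vge_add (h : VGe R 1 (S + c₂)) :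
    VEq R 0 (duplicationNumerator c₂ c₄ c₆ S) := by
  obtain ⟨h4, hc4, _, _⟩ := H.exists_vge_c₄
  have hM := H.one_le
  have hS := H.veq_of_vge_add h
  have e : duplicationNumerator c₂ c₄ c₆ S = S ^ 4 + (-(2 * c₄ * S ^ 2) + -(8 * c₆ * S) +
    (c₄ ^ 2 - 4 * c₂ * c₆)) := by rw [duplicationNumerator]; ring
  rw [e]
  refine (hS.pow 4 rfl).add ((VGe.add (VGe.neg ?_) (VGe.neg ?_)).add ?_)
  · exact ((vge_ofNat 2).mul hc4 le_rfl).mul ((hS.pow 2 rfl).vge le_rfl) (by push_cast; omega)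
  · exact ((vge_ofNat 8).mul H.vge_c₆ le_rfl).mul (hS.vge le_rfl) (by push_cast; omega)
  · exact H.veq_disc.vge (by push_cast; omega)

/-- If `0 < 2 v(S) < M`, the cubic has the even valuation `2 v(S)` at `S`; so at a point of the
curve above the double root, `2 v(S) ≥ M`. -/
lemma exists_vge_of_vge (h : VGe R 1 S) (hodd : ∀ n, VEq R n (cubicEval c₂ c₄ c₆ S) → Odd n) :
    ∃ k : ℤ, VGe R k S ∧ M ≤ 2 * k := by
  obtain ⟨h4, hc4, _, _⟩ := H.exists_vge_c₄
  rcases vge_or_veq (R := R) h4 S with h' | ⟨m, hm, h'⟩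
  · exact ⟨h4, h', by omega⟩
  refine ⟨m, h'.vge le_rfl, ?_⟩
  by_contra! hlt
  have h1 := h'.le h
  have h2 : VEq R (2 * m) (cubicEval c₂ c₄ c₆ S) := by
    have e : cubicEval c₂ c₄ c₆ S = c₂ * S ^ 2 + (S ^ 3 + c₄ * S + c₆) := by rw [cubicEval]; ring
    rw [e]
    refine (H.veq_c₂.mul (h'.pow 2 rfl) (by push_cast; ring)).add ((VGe.add ?_ ?_).add ?_)
    · exact (h'.pow 3 rfl).vge (by push_cast; omega)
    · exact hc4.mul (h'.vge le_rfl) (by omega)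
    · exact H.vge_c₆.mono (by omega)
  exact absurd (hodd _ h2) (by simp)

lemma vge_cubicEval_of_vge {k : ℤ} (h1 : 1 ≤ k) (h : VGe R k S) (hk : M ≤ 2 * k) :
    VGe R M (cubicEval c₂ c₄ c₆ S) := by
  obtain ⟨h4, hc4, _, _⟩ := H.exists_vge_c₄
  refine ((VGe.add ?_ ?_).add ?_).add H.vge_c₆
  · exact h.pow 3 (by push_cast; omega)
  · exact (H.veq_c₂.vge le_rfl).mul (h.pow 2 le_rfl) (by push_cast; omega)
  · exact hc4.mul h (by omega)

lemma veq_duplicationNumerator_of_vge {k : ℤ} (h : VGe R k S) (hk : M ≤ 2 * k) :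
    VEq R M (duplicationNumerator c₂ c₄ c₆ S) := by
  obtain ⟨h4, hc4, _, _⟩ := H.exists_vge_c₄
  have hM := H.one_le
  have e : duplicationNumerator c₂ c₄ c₆ S = (c₄ ^ 2 - 4 * c₂ * c₆) + (S ^ 4 + -(2 * c₄ * S ^ 2) +
    -(8 * c₆ * S)) := by rw [duplicationNumerator]; ring
  rw [e]
  refine H.veq_disc.add ((VGe.add ?_ (VGe.neg ?_)).add (VGe.neg ?_))
  · exact h.pow 4 (by push_cast; omega)
  · exact ((vge_ofNat 2).mul hc4 le_rfl).mul (h.pow 2 le_rfl) (by push_cast; omega)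
  · exact ((vge_ofNat 8).mul H.vge_c₆ le_rfl).mul h (by omega)

/-- The duplication formula for `starHeight`. Here `S'` is the coordinate of the double of a
point with coordinate `S`; that the cubic has odd valuation, or vanishes, at both reflects that
the curve is a ramified quadratic twist of the one given by the cubic. -/
lemma starHeight_duplication (h4 : VEq R 0 (4 : K)) {S' : K}
    (hS : cubicEval c₂ c₄ c₆ S ≠ 0)
    (hodd : ∀ n, VEq R n (cubicEval c₂ c₄ c₆ S) → Odd n)
    (hodd' : ∀ n, VEq R n (cubicEval c₂ c₄ c₆ S') → Odd n)
    (hdup : S' * (4 * cubicEval c₂ c₄ c₆ S) = duplicationNumerator c₂ c₄ c₆ S) :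
    starHeight R M c₂ S' = 4 * starHeight R M c₂ S +
      (ord R (cubicEval c₂ c₄ c₆ S) : ℝ) / 2 - (M : ℝ) / 4 := by
  have hM := H.one_le
  obtain ⟨s, hs⟩ := exists_veq (R := R) hS
  have hS' {k : ℤ} (hk : VEq R k (duplicationNumerator c₂ c₄ c₆ S)) : VEq R (k - s) S' := by
    rw [eq_div_of_mul_eq (mul_ne_zero h4.ne_zero hS) hdup]
    exact hk.div (h4.mul hs rfl) (by omega)
  rw [hs.ord]
  rcases vge_or_veq (R := R) 0 S with h0 | ⟨n, hn, h0⟩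
  · rcases H.vge_add_or_vge h0 hodd with h1 | h1
    -- `S` near the simple root: the double has coordinate of valuation `-s < 0`.
    · have h2 := hs.le (H.vge_cubicEval_of_vge_add h1)
      have h3 := hS' (H.veq_duplicationNumerator_of_vge_add h1)
      rw [starHeight_of_vge_add (H.veq_c₂.vge le_rfl) h1, starHeight_of_veq h3 (by omega)]
      push_cast
      ring
    -- `S` near the double root: the double has coordinate of valuation `M - s ≤ 0`.
    · obtain ⟨k, hk, hk'⟩ := H.exists_vge_of_vge h1 hodd
      have h2 := hs.le (H.vge_cubicEval_of_vge (by omega) hk hk')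
      have h3 := hS' (H.veq_duplicationNumerator_of_vge hk hk')
      rw [starHeight_of_vge H.veq_c₂ h1]
      rcases h2.eq_or_lt with rfl | h2
      -- If `s = M`, then `S'` is a unit at which the cubic has odd valuation or vanishes.
      · rw [sub_self] at h3
        rcases H.vge_add_or_vge (h3.vge le_rfl) hodd' with h4 | h4
        · rw [starHeight_of_vge_add (H.veq_c₂.vge le_rfl) h4]
          ring
        · have := h3.le h4
          omega
      · rw [starHeight_of_veq h3 (by omega)]
        push_cast
        ring
  · have h2 := hs.unique (H.veq_cubicEval_of_neg h0 hn)
    have h3 := hS' (H.veq_duplicationNumerator_of_neg h0 hn)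
    rw [starHeight_of_veq h0 hn, starHeight_of_veq h3 (by omega), h2]
    push_cast
    ring

end IsStarCubic

end Cubic

/-! ### Duplication of points -/

section Duplication

variable {F : Type*} [Field F] {W : WeierstrassCurve F} {x y : F}

lemma sq_two_mul_y_add (h : W.toAffine.Equation x y) :
    (2 * y + W.a₁ * x + W.a₃) ^ 2 = 4 * x ^ 3 + W.b₂ * x ^ 2 + 2 * W.b₄ * x + W.b₆ := by
  rw [Affine.equation_iff] at h
  simp only [b₂, b₄, b₆]
  linear_combination 4 * h

lemma eq_negY_iff : y = W.toAffine.negY x y ↔ 2 * y + W.a₁ * x + W.a₃ = 0 := by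
  rw [Affine.negY, ← sub_eq_zero]
  ring_nf

variable [DecidableEq F]

lemma two_smul_some_eq_zero {h : W.toAffine.Nonsingular x y}
    (h0 : 2 * y + W.a₁ * x + W.a₃ = 0) : 2 • Affine.Point.some x y h = 0 := by
  rw [two_smul]
  exact Affine.Point.add_self_of_Y_eq (eq_negY_iff.2 h0)

lemma exists_two_smul_some (h : W.toAffine.Nonsingular x y)
    (h0 : 2 * y + W.a₁ * x + W.a₃ ≠ 0) :
    ∃ x' y' h', 2 • Affine.Point.some x y h = Affine.Point.some x' y' h' ∧
      x' * (2 * y + W.a₁ * x + W.a₃) ^ 2 = x ^ 4 - W.b₄ * x ^ 2 - 2 * W.b₆ * x - W.b₈ := by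
  have hy : y ≠ W.toAffine.negY x y := fun h => h0 (eq_negY_iff.1 h)
  refine ⟨_, _, _, (two_smul _ _).trans (Affine.Point.add_self_of_Y_ne hy), ?_⟩
  have e : y - W.toAffine.negY x y = 2 * y + W.a₁ * x + W.a₃ := by rw [Affine.negY]; ring
  have heq := (Affine.equation_iff ..).1 h.left
  have e' (n ψ : F) (hψ : ψ ≠ 0) : ((n / ψ) ^ 2 + W.a₁ * (n / ψ) - W.a₂ - x - x) * ψ ^ 2 =
      n ^ 2 + W.a₁ * n * ψ - (W.a₂ + 2 * x) * ψ ^ 2 := by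
    field_simp
    ring
  rw [Affine.slope_of_Y_ne rfl hy, e, Affine.addX, e' _ _ h0]
  simp only [b₄, b₆, b₈]
  linear_combination -(W.a₁ ^ 2 + 4 * W.a₂ + 8 * x) * heq

end Duplication

/-! ### Equations of type `I_M^*` -/

section IStarEquation

variable {R : Type*} [CommRing R] [IsDomain R] [IsDiscreteValuationRing R]
  {K : Type u} [Field K] [Algebra R K] [IsFractionRing R K]

lemma IsIStarEquation.valuations {ϖ : R} (hϖ : Irreducible ϖ) {A : WeierstrassCurve R} {M : ℕ}
    (h : IsIStarEquation ϖ A M) :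
    VGe R 1 (algebraMap R K A.a₁) ∧ VEq R 1 (algebraMap R K A.a₂) ∧
    ∃ m : ℕ, VGe R (m + 3) (algebraMap R K A.a₄) ∧
      ((M = 2 * m + 1 ∧ VGe R (m + 2) (algebraMap R K A.a₃) ∧
        VGe R (2 * m + 4) (algebraMap R K A.a₆) ∧ VEq R (2 * m + 4) (algebraMap R K A.b₆)) ∨
      (M = 2 * m + 2 ∧ VGe R (m + 3) (algebraMap R K A.a₃) ∧
        VGe R (2 * m + 5) (algebraMap R K A.a₆) ∧
        VEq R (2 * m + 6) (algebraMap R K (A.a₄ ^ 2 - 4 * A.a₂ * A.a₆)))) := by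
  have hp (i : ℕ) := (veq_uniformizer (K := K) hϖ).pow i (k := i) (by omega)
  have h0 {r : R} (hr : ¬ ϖ ∣ r) : VEq R 0 (algebraMap R K r) := by
    rw [veq_zero_algebraMap, Ne, ← vge_one_algebraMap (K := K), vge_one_dvd hϖ]
    exact hr
  obtain ⟨ha1, ⟨c, hc⟩, ha2', h⟩ := h
  have hc' : ¬ ϖ ∣ c := by
    rintro ⟨d, rfl⟩
    exact ha2' ⟨d, by rw [hc]; ring⟩
  refine ⟨(vge_one_dvd hϖ).2 ha1, ?_, ?_⟩
  · rw [hc, map_mul]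
    exact (veq_uniformizer hϖ).mul (h0 hc') (by norm_num)
  rcases h with ⟨m, a, b, hM, h3, h4, h6, hd⟩ | ⟨m, c', a, b, hM, h3, h2, h4, h6, hd⟩
  · refine ⟨m, vge_of_dvd hϖ h4 (by push_cast; omega), .inl ⟨hM, ?_, ?_, ?_⟩⟩
    · exact vge_of_dvd hϖ ⟨a, h3⟩ (by push_cast; omega)
    · exact vge_of_dvd hϖ ⟨b, h6⟩ (by push_cast; omega)
    · rw [show A.b₆ = ϖ ^ (2 * m + 4) * (a ^ 2 + 4 * b) by rw [b₆, h3, h6]; ring, map_mul, map_pow]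
      exact (hp _).mul (h0 hd) (by push_cast; ring)
  · obtain rfl : c' = c := mul_left_cancel₀ hϖ.ne_zero (h2.symm.trans hc)
    refine ⟨m, vge_of_dvd hϖ ⟨a, h4⟩ (by push_cast; omega), .inr ⟨hM, ?_, ?_, ?_⟩⟩
    · exact vge_of_dvd hϖ h3 (by push_cast; omega)
    · exact vge_of_dvd hϖ ⟨b, h6⟩ (by push_cast; omega)
    · rw [show A.a₄ ^ 2 - 4 * A.a₂ * A.a₆ = ϖ ^ (2 * m + 6) * (a ^ 2 - 4 * c' * b) by
        rw [hc, h4, h6]; ring, map_mul, map_pow]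
      exact (hp _).mul (h0 hd) (by push_cast; ring)

/-- In terms of the `b`-invariants both parities of `M` take the same form: `v(b₂) = 1`,
`2 v(b₄) ≥ M + 4`, `v(b₆) ≥ M + 3` and `v(b₄² - b₂ b₆) = M + 4`. -/
lemma IsIStarEquation.valuations_b {ϖ : R} (hϖ : Irreducible ϖ) {A : WeierstrassCurve R} {M : ℕ}
    (h2 : (2 : ResidueField R) ≠ 0) (h : IsIStarEquation ϖ A M) :
    VEq R 1 (algebraMap R K A.b₂) ∧ VGe R (M + 4) (algebraMap R K A.b₄ ^ 2) ∧
    VGe R (M + 3) (algebraMap R K A.b₆) ∧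
    VEq R (M + 4) (algebraMap R K A.b₄ ^ 2 - algebraMap R K A.b₂ * algebraMap R K A.b₆) := by
  obtain ⟨h1, ha2, m, ha4, hm⟩ := h.valuations (K := K) hϖ
  have h4 := veq_four (K := K) h2
  have two := (veq_two (K := K) h2).vge le_rfl
  have four := h4.vge le_rfl
  have hb2 : VEq R 1 (algebraMap R K A.b₂) := by
    rw [b₂, map_add, map_pow, map_mul, map_ofNat, add_comm]
    exact (h4.mul ha2 rfl).add (h1.pow 2 (by norm_num))
  have hb4 : VGe R (m + 3) (algebraMap R K A.b₄) := by
    rw [b₄, map_add, map_mul, map_mul, map_ofNat]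
    refine VGe.add (two.mul ha4 (by omega)) ?_
    rcases hm with ⟨-, h3, -⟩ | ⟨-, h3, -⟩ <;> exact h1.mul h3 (by omega)
  refine ⟨hb2, hb4.pow 2 ?_, ?_, ?_⟩
  · rcases hm with ⟨h, -⟩ | ⟨h, -⟩ <;> push_cast <;> omega
  · rcases hm with ⟨hM, h3, h6, h7⟩ | ⟨hM, h3, h6, h7⟩
    · exact h7.vge (by omega)
    · rw [b₆, map_add, map_pow, map_mul, map_ofNat]
      exact (h3.pow 2 (by push_cast; omega)).add (four.mul h6 (by omega))
  · rcases hm with ⟨hM, h3, h6, h7⟩ | ⟨hM, h3, h6, h7⟩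
    · rw [sub_eq_add_neg, add_comm (_ ^ 2)]
      exact (hb2.mul h7 (by omega)).neg.add (hb4.pow 2 (by push_cast; omega))
    · have e : algebraMap R K A.b₄ ^ 2 - algebraMap R K A.b₂ * algebraMap R K A.b₆ =
          4 * algebraMap R K (A.a₄ ^ 2 - 4 * A.a₂ * A.a₆) +
          4 * (algebraMap R K A.a₄ * (algebraMap R K A.a₁ * algebraMap R K A.a₃) -
            algebraMap R K A.a₁ ^ 2 * algebraMap R K A.a₆ -
            algebraMap R K A.a₂ * algebraMap R K A.a₃ ^ 2) := by
        simp only [b₂, b₄, b₆, map_add, map_mul, map_sub, map_pow, map_ofNat]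
        ring
      rw [e]
      refine (h4.mul h7 (by omega)).add (four.mul (n := 0) (m := 2 * m + 7) (((ha4.mul (h1.mul h3
        le_rfl) ?_).sub ((h1.pow 2 le_rfl).mul h6 ?_)).sub ((ha2.vge le_rfl).mul (h3.pow 2 le_rfl)
          ?_)) ?_)
      all_goals push_cast; omega

end IStarEquation

namespace IStarModel

variable {R : Type*} [CommRing R] [IsDomain R] [IsDiscreteValuationRing R]
  {K : Type u} [Field K] [Algebra R K] [IsFractionRing R K] {W : WeierstrassCurve K} {M : ℕ}
  (T : IStarModel R W M)

/-- The uniformizer as an element of the field. -/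
abbrev ϖK : K := algebraMap R K T.ϖ

/-- The quadratic coefficient of the cubic of the model: with `S = X / ϖ`, the right-hand side of
the equation with completed square is `ϖ³ (S³ + c₂ S² + c₄ S + c₆)`. -/
def cubic₂ : K := algebraMap R K T.A.b₂ / (4 * T.ϖK)

/-- The linear coefficient of the cubic of the model. -/
def cubic₄ : K := algebraMap R K T.A.b₄ / (2 * T.ϖK ^ 2)

/-- The constant coefficient of the cubic of the model. -/
def cubic₆ : K := algebraMap R K T.A.b₆ / (4 * T.ϖK ^ 3)

/-- The coordinate `S = X / ϖ` in terms of the `x`-coordinate on the original equation. -/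
def sCoord (x : K) : K := (x - T.C.r) / (T.C.u ^ 2 * T.ϖK)

lemma veq_ϖ : VEq R 1 T.ϖK := veq_uniformizer T.irreducible

lemma isStarCubic (h2 : (2 : ResidueField R) ≠ 0) (hM : 1 ≤ M) :
    IsStarCubic R M T.cubic₂ T.cubic₄ T.cubic₆ := by
  obtain ⟨hb2, hb4, hb6, hd⟩ := T.isIStar.valuations_b (K := K) T.irreducible h2
  have two := veq_two (K := K) h2
  have four := veq_four (K := K) h2
  have hϖ := T.veq_ϖ
  refine ⟨by exact_mod_cast hM, hb2.div (four.mul hϖ rfl) (by norm_num), ?_,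
    hb6.div (four.mul (hϖ.pow 3 rfl) rfl) (by push_cast; omega), ?_⟩
  · rw [cubic₄, div_pow]
    exact hb4.div ((two.mul (hϖ.pow 2 rfl) rfl).pow 2 rfl) (by push_cast; omega)
  · have e : T.cubic₄ ^ 2 - 4 * T.cubic₂ * T.cubic₆ = (algebraMap R K T.A.b₄ ^ 2 -
        algebraMap R K T.A.b₂ * algebraMap R K T.A.b₆) / (4 * T.ϖK ^ 4) := by
      have := two.ne_zero
      have := four.ne_zero
      have := hϖ.ne_zero
      rw [cubic₂, cubic₄, cubic₆]
      field_simp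
      ring
    rw [e]
    exact hd.div (four.mul (hϖ.pow 4 rfl) rfl) (by push_cast; omega)

lemma x_eq (x : K) : x = T.C.u ^ 2 * T.ϖK * T.sCoord x + T.C.r := by
  have := T.veq_ϖ.ne_zero
  rw [sCoord, mul_div_cancel₀ _ (mul_ne_zero (pow_ne_zero _ T.C.u.ne_zero) this)]
  ring

omit [IsDomain R] [IsDiscreteValuationRing R] [IsFractionRing R K] in
lemma Δ_eq : W.Δ = T.C.u ^ 12 * algebraMap R K T.A.Δ := by
  have h := variableChange_Δ W T.C
  rw [T.smul_eq, map_Δ] at h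
  rw [h, Units.val_inv_eq_inv_val, inv_pow, mul_inv_cancel_left₀ (pow_ne_zero _ T.C.u.ne_zero)]

variable (h2 : (2 : ResidueField R) ≠ 0)
include h2

lemma b₂_eq : W.b₂ = 4 * T.C.u ^ 2 * T.ϖK * T.cubic₂ - 12 * T.C.r := by
  have h := variableChange_b₂ W T.C
  rw [T.smul_eq, map_b₂] at h
  have := (veq_four (R := R) (K := K) h2).ne_zero
  have := T.veq_ϖ.ne_zero
  rw [cubic₂, h, Units.val_inv_eq_inv_val]
  field_simp
  ring

lemma b₄_eq : W.b₄ = 2 * T.C.u ^ 4 * T.ϖK ^ 2 * T.cubic₄ - T.C.r * W.b₂ - 6 * T.C.r ^ 2 := by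
  have h := variableChange_b₄ W T.C
  rw [T.smul_eq, map_b₄] at h
  have := (veq_two (R := R) (K := K) h2).ne_zero
  have := T.veq_ϖ.ne_zero
  rw [cubic₄, h, Units.val_inv_eq_inv_val]
  field_simp
  ring

lemma b₆_eq : W.b₆ = 4 * T.C.u ^ 6 * T.ϖK ^ 3 * T.cubic₆ - 2 * T.C.r * W.b₄ - T.C.r ^ 2 * W.b₂ -
    4 * T.C.r ^ 3 := by
  have h := variableChange_b₆ W T.C
  rw [T.smul_eq, map_b₆] at h
  have := (veq_four (R := R) (K := K) h2).ne_zero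
  have := T.veq_ϖ.ne_zero
  rw [cubic₆, h, Units.val_inv_eq_inv_val]
  field_simp
  ring

/-- The Weierstrass equation with completed square, in the coordinate `S`. -/
lemma sq_eq_cubicEval {x y : K} (h : W.toAffine.Equation x y) :
    (2 * y + W.a₁ * x + W.a₃) ^ 2 =
      4 * T.C.u ^ 6 * T.ϖK ^ 3 * cubicEval T.cubic₂ T.cubic₄ T.cubic₆ (T.sCoord x) := by
  have hx := T.x_eq x
  generalize T.sCoord x = S at *
  rw [sq_two_mul_y_add h, T.b₆_eq h2, T.b₄_eq h2, T.b₂_eq h2, hx, cubicEval]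
  ring

/-- As `ψ² = 4 u⁶ ϖ³ g(S)` for `ψ = 2 y + a₁ x + a₃`, the valuation of `g(S)` at a point of the
curve is odd, unless `g(S) = 0`. -/
lemma odd_of_veq_cubicEval {x y : K} (h : W.toAffine.Equation x y) (n : ℤ)
    (hn : VEq R n (cubicEval T.cubic₂ T.cubic₄ T.cubic₆ (T.sCoord x))) : Odd n := by
  have e := T.sq_eq_cubicEval h2 h
  obtain ⟨u, hu⟩ := exists_veq (R := R) T.C.u.ne_zero
  have h1 := (((veq_four (R := R) (K := K) h2).mul (hu.pow 6 rfl) rfl).mul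
    (T.veq_ϖ.pow 3 rfl) rfl).mul hn rfl
  rw [← e] at h1
  obtain ⟨k, hk⟩ := exists_veq (R := R) (pow_ne_zero_iff two_ne_zero |>.1 h1.ne_zero)
  have h3 := (hk.pow 2 rfl).unique h1
  push_cast at h3
  rw [Int.odd_iff]
  omega

lemma sCoord_duplication {x ψ x' : K}
    (hc : ψ ^ 2 = 4 * T.C.u ^ 6 * T.ϖK ^ 3 * cubicEval T.cubic₂ T.cubic₄ T.cubic₆ (T.sCoord x))
    (h : x' * ψ ^ 2 = x ^ 4 - W.b₄ * x ^ 2 - 2 * W.b₆ * x - W.b₈) :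
    T.sCoord x' * (4 * cubicEval T.cubic₂ T.cubic₄ T.cubic₆ (T.sCoord x)) =
      duplicationNumerator T.cubic₂ T.cubic₄ T.cubic₆ (T.sCoord x) := by
  have four := (veq_four (R := R) (K := K) h2).ne_zero
  have hϖ := T.veq_ϖ.ne_zero
  have hu := T.C.u.ne_zero
  have hx := T.x_eq x
  have hx' := T.x_eq x'
  have h8 := W.b_relation
  generalize T.sCoord x = S at *
  generalize T.sCoord x' = S' at *
  rw [hc] at h
  have h9 : 4 * (T.C.u ^ 8 * T.ϖK ^ 4 * (S' * (4 * cubicEval T.cubic₂ T.cubic₄ T.cubic₆ S))) =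
      4 * (T.C.u ^ 8 * T.ϖK ^ 4 * duplicationNumerator T.cubic₂ T.cubic₄ T.cubic₆ S) := by
    rw [hx, hx', T.b₆_eq h2, T.b₄_eq h2, T.b₂_eq h2, cubicEval] at h
    rw [T.b₆_eq h2, T.b₄_eq h2, T.b₂_eq h2] at h8
    rw [cubicEval, duplicationNumerator]
    linear_combination 4 * h - h8
  exact mul_left_cancel₀ (mul_ne_zero (pow_ne_zero 8 hu) (pow_ne_zero 4 hϖ))
    (mul_left_cancel₀ four h9)

lemma veq_Δ (hM : 1 ≤ M) : VEq R (M + 6) (algebraMap R K T.A.Δ) := by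
  have H := T.isStarCubic h2 hM
  obtain ⟨h, hc4, _, _⟩ := H.exists_vge_c₄
  have four := veq_four (R := R) (K := K) h2
  have hϖ := T.veq_ϖ
  have e2 : algebraMap R K T.A.b₂ = 4 * T.ϖK * T.cubic₂ := by
    rw [cubic₂, mul_div_cancel₀ _ (four.mul hϖ rfl).ne_zero]
  have e4 : algebraMap R K T.A.b₄ = 2 * T.ϖK ^ 2 * T.cubic₄ := by
    rw [cubic₄, mul_div_cancel₀ _ ((veq_two h2).mul (hϖ.pow 2 rfl) rfl).ne_zero]
  have e6 : algebraMap R K T.A.b₆ = 4 * T.ϖK ^ 3 * T.cubic₆ := by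
    rw [cubic₆, mul_div_cancel₀ _ (four.mul (hϖ.pow 3 rfl) rfl).ne_zero]
  have e8 := congrArg (algebraMap R K) T.A.b_relation
  simp only [map_mul, map_sub, map_pow, map_ofNat, e2, e4, e6] at e8
  have e8' : algebraMap R K T.A.b₈ = T.ϖK ^ 4 * (4 * T.cubic₂ * T.cubic₆ - T.cubic₄ ^ 2) :=
    mul_left_cancel₀ four.ne_zero (by rw [e8]; ring)
  have e : algebraMap R K T.A.Δ = 4 ^ 2 * T.ϖK ^ 6 * (T.cubic₂ ^ 2 *
      (T.cubic₄ ^ 2 - 4 * T.cubic₂ * T.cubic₆) + (-(4 * T.cubic₄ ^ 3) - 27 * T.cubic₆ ^ 2 +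
        18 * T.cubic₂ * T.cubic₄ * T.cubic₆)) := by
    simp only [Δ, map_add, map_mul, map_sub, map_neg, map_pow, map_ofNat, e2, e4, e6, e8']
    ring
  rw [e]
  refine ((four.pow 2 rfl).mul (hϖ.pow 6 rfl) rfl).mul (m := M) (VEq.add
    ((H.veq_c₂.pow 2 rfl).mul H.veq_disc (by norm_num)) ((VGe.sub (VGe.neg ?_) ?_).add ?_))
    (by push_cast; omega)
  · exact (vge_ofNat 4).mul (hc4.pow 3 le_rfl) (by push_cast; omega)
  · exact (vge_ofNat 27).mul (H.vge_c₆.pow 2 le_rfl) (by push_cast; omega)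
  · exact (((vge_ofNat 18).mul (H.veq_c₂.vge le_rfl) le_rfl).mul hc4 le_rfl).mul H.vge_c₆
      (by push_cast; omega)

/-- The change of variables to the model has invertible `u` if the discriminants agree. -/
lemma veq_u (hM : 1 ≤ M) (hΔ : VEq R (M + 6) W.Δ) : VEq R 0 (T.C.u : K) := by
  obtain ⟨u, hu⟩ := exists_veq (R := R) T.C.u.ne_zero
  have h := (hu.pow 12 rfl).mul (T.veq_Δ h2 hM) rfl
  rw [← T.Δ_eq] at h
  have := h.unique hΔ
  push_cast at this
  obtain rfl : u = 0 := by omega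
  exact hu

/-- A change of variables with invertible `u` between integral equations is integral. -/
lemma vge_rst (h3 : (3 : ResidueField R) ≠ 0) (hW : W.IsIntegral R) (hu : VEq R 0 (T.C.u : K)) :
    VGe R 0 T.C.r ∧ VGe R 0 T.C.s ∧ VGe R 0 T.C.t := by
  have two := veq_two (R := R) (K := K) h2
  have three := veq_three (R := R) (K := K) h3
  have hu' (i : ℕ) : VGe R 0 ((T.C.u : K) ^ i) := (hu.vge le_rfl).pow i (by simp)
  have e1 := variableChange_a₁ W T.C
  have e2 := variableChange_a₂ W T.C
  have e3 := variableChange_a₃ W T.C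
  simp only [T.smul_eq, map_a₁, map_a₂, map_a₃, Units.val_inv_eq_inv_val] at e1 e2 e3
  have h1 : VGe R 0 W.a₁ := integralModel_a₁_eq R W ▸ vge_algebraMap _
  have h2 : VGe R 0 W.a₂ := integralModel_a₂_eq R W ▸ vge_algebraMap _
  have h3 : VGe R 0 W.a₃ := integralModel_a₃_eq R W ▸ vge_algebraMap _
  have hs : VGe R 0 T.C.s := by
    refine VGe.of_mul (a := 2) ?_ two (by norm_num) (k := 0)
    rw [show 2 * T.C.s = (T.C.u : K) ^ 1 * algebraMap R K T.A.a₁ - W.a₁ by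
      rw [e1]; field_simp; ring]
    exact ((hu' 1).mul (vge_algebraMap _) (by norm_num)).sub h1
  have hr : VGe R 0 T.C.r := by
    refine VGe.of_mul (a := 3) ?_ three (by norm_num) (k := 0)
    rw [show 3 * T.C.r = (T.C.u : K) ^ 2 * algebraMap R K T.A.a₂ - W.a₂ + T.C.s * W.a₁ +
      T.C.s ^ 2 by rw [e2]; field_simp; ring]
    exact ((((hu' 2).mul (vge_algebraMap _) (by norm_num)).sub h2).add
      (hs.mul h1 (by norm_num))).add (hs.pow 2 (by norm_num))
  refine ⟨hr, hs, ?_⟩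
  refine VGe.of_mul (a := 2) ?_ two (by norm_num) (k := 0)
  rw [show 2 * T.C.t = (T.C.u : K) ^ 3 * algebraMap R K T.A.a₃ - W.a₃ - T.C.r * W.a₁ by
    rw [e3]; field_simp; ring]
  exact (((hu' 3).mul (vge_algebraMap _) (by norm_num)).sub h3).sub (hr.mul h1 (by norm_num))

end IStarModel

/-! ### Components of the special fibre -/

section Components

variable {R : Type*} [CommRing R] [IsDomain R] [IsDiscreteValuationRing R]
  {K : Type u} [Field K] [Algebra R K] [IsFractionRing R K]

lemma starHeight_congr {M : ℤ} {c₂ S S' : K} (h : VGe R 1 (S - S')) :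
    starHeight R M c₂ S = starHeight R M c₂ S' := by
  have key {S S' : K} (h : VGe R 1 (S - S')) (h0 : VGe R 0 S) :
      starHeight R M c₂ S = starHeight R M c₂ S' := by
    have e0 : VGe R 0 S' := by simpa using h0.sub (h.mono (m := 0) (by omega))
    have e1 : VGe R 1 (S + c₂) ↔ VGe R 1 (S' + c₂) :=
      ⟨fun h1 => by convert h1.sub h using 1; ring, fun h1 => by convert h1.add h using 1; ring⟩
    rw [starHeight, if_pos h0, starHeight, if_pos e0]
    by_cases h1 : VGe R 1 (S + c₂)
    · rw [if_pos h1, if_pos (e1.1 h1)]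
    · rw [if_neg h1, if_neg fun h => h1 (e1.2 h)]
  rcases vge_or_veq (R := R) 0 S with h0 | ⟨n, hn, h0⟩
  · exact key h h0
  · have h1 : VEq R n S' := h0.congr (by
      rw [← neg_sub]
      exact h.neg.mono (by omega))
    rw [starHeight_of_veq h0 hn, starHeight_of_veq h1 hn]

namespace IStarModel

variable {W : WeierstrassCurve K} {M : ℕ} (T : IStarModel R W M)

/-- The `Y`-coordinate on the model of the point `(x, y)` of the original equation. -/
def modelY (x y : K) : K :=
  (y - T.C.u ^ 2 * T.C.s * (T.ϖK * T.sCoord x) - T.C.t) / T.C.u ^ 3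

omit [IsDomain R] [IsDiscreteValuationRing R] [IsFractionRing R K] in
lemma y_eq (x y : K) : y = T.C.u ^ 3 * T.modelY x y + T.C.u ^ 2 * T.C.s * (T.ϖK * T.sCoord x) +
    T.C.t := by
  rw [modelY, mul_div_cancel₀ _ (pow_ne_zero _ T.C.u.ne_zero)]
  ring

lemma two_mul_modelY (x y : K) : 2 * T.modelY x y + algebraMap R K T.A.a₁ * (T.ϖK * T.sCoord x) +
    algebraMap R K T.A.a₃ = (2 * y + W.a₁ * x + W.a₃) / T.C.u ^ 3 := by
  have e1 := variableChange_a₁ W T.C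
  have e3 := variableChange_a₃ W T.C
  simp only [T.smul_eq, map_a₁, map_a₃, Units.val_inv_eq_inv_val] at e1 e3
  have hx := T.x_eq x
  have hy := T.y_eq x y
  generalize T.sCoord x = S at *
  generalize T.modelY x y = Y at *
  rw [e1, e3, hx, hy]
  field_simp
  ring

lemma hasCoordinates_some_iff {X Y x y : K} {h : W.toAffine.Nonsingular x y} :
    HasCoordinates T.C X Y (.some x y h) ↔ X = T.ϖK * T.sCoord x ∧ Y = T.modelY x y := by
  have hu := T.C.u.ne_zero
  have hϖ := T.veq_ϖ.ne_zero
  have hx := T.x_eq x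
  have hy := T.y_eq x y
  constructor
  · rintro ⟨h1, h2⟩
    obtain rfl : X = T.ϖK * T.sCoord x :=
      mul_left_cancel₀ (pow_ne_zero 2 hu) (by linear_combination hx - h1)
    exact ⟨rfl, mul_left_cancel₀ (pow_ne_zero 3 hu) (by linear_combination hy - h2)⟩
  · rintro ⟨rfl, rfl⟩
    exact ⟨by linear_combination hx, hy⟩

variable (h2 : (2 : ResidueField R) ≠ 0) (hu : VEq R 0 (T.C.u : K))
include h2 hu

lemma vge_modelY {x y : K} {k : ℤ} (hψ : VGe R k (2 * y + W.a₁ * x + W.a₃))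
    (h1 : VGe R (k - 2) (T.sCoord x)) (h3 : VGe R k (algebraMap R K T.A.a₃)) :
    VGe R k (T.modelY x y) := by
  have e := T.two_mul_modelY x y
  refine VGe.of_mul (k := k) (a := 2) ?_ (veq_two h2) (by omega)
  rw [show 2 * T.modelY x y = (2 * y + W.a₁ * x + W.a₃) / T.C.u ^ 3 -
    algebraMap R K T.A.a₁ * (T.ϖK * T.sCoord x) - algebraMap R K T.A.a₃ by rw [← e]; ring]
  refine ((hψ.div (hu.pow 3 rfl) (by simp)).sub ?_).sub h3
  exact ((vge_one_dvd T.irreducible).2 T.isIStar.1).mul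
    ((T.veq_ϖ.vge le_rfl).mul h1 le_rfl) (by omega)

lemma vge_ψ {x y : K} (h : W.toAffine.Equation x y) {k n : ℤ}
    (hg : VGe R k (cubicEval T.cubic₂ T.cubic₄ T.cubic₆ (T.sCoord x))) (hn : 2 * n ≤ k + 4) :
    VGe R n (2 * y + W.a₁ * x + W.a₃) := by
  refine VGe.of_pow 2 (k := k + 3) ?_ (by push_cast; omega)
  rw [T.sq_eq_cubicEval h2 h]
  exact ((((veq_four h2).mul (hu.pow 6 rfl) rfl).mul (T.veq_ϖ.pow 3 rfl) rfl).vge le_rfl).mul hg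
    (by push_cast; omega)

lemma hitsAlpha_iff {x y : K} (h : W.toAffine.Nonsingular x y) (hM : 1 ≤ M) :
    T.HitsAlpha (.some x y h) ↔ VGe R 1 (T.sCoord x + T.cubic₂) := by
  have two := veq_two (R := R) (K := K) h2
  have four := veq_four (R := R) (K := K) h2
  have hϖ := T.veq_ϖ
  obtain ⟨ha1, ha2, m, ha4, hm⟩ := T.isIStar.valuations (K := K) T.irreducible
  have H := T.isStarCubic h2 hM
  have e : T.ϖK * (T.sCoord x + T.cubic₂) = T.ϖK * T.sCoord x + algebraMap R K T.A.a₂ +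
      algebraMap R K T.A.a₁ ^ 2 / 4 := by
    have := four.ne_zero
    have := hϖ.ne_zero
    rw [cubic₂, b₂]
    simp only [map_add, map_mul, map_pow, map_ofNat]
    field_simp
    ring
  have hA : VGe R 2 (algebraMap R K T.A.a₁ ^ 2 / 4) := (ha1.pow 2 le_rfl).div four (by norm_num)
  constructor
  · rintro ⟨p, q, hpq⟩
    obtain ⟨hX, -⟩ := T.hasCoordinates_some_iff.1 hpq
    refine VGe.of_mul (k := 2) (a := T.ϖK) ?_ hϖ (by norm_num)
    rw [e, ← hX]
    refine VGe.add ?_ hA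
    simp only [map_add, map_mul, map_neg, map_pow, neg_add_cancel_comm]
    exact ((hϖ.pow 2 rfl).vge le_rfl).mul (vge_algebraMap p) (by norm_num)
  · intro h1
    have h3 : VGe R ((2 : ℕ) : ℤ) (T.ϖK * T.sCoord x + algebraMap R K T.A.a₂) := by
      rw [show T.ϖK * T.sCoord x + algebraMap R K T.A.a₂ = T.ϖK * (T.sCoord x + T.cubic₂) -
        algebraMap R K T.A.a₁ ^ 2 / 4 by rw [e]; ring]
      exact VGe.sub ((hϖ.vge le_rfl).mul h1 (by norm_num)) hA
    have h4 : VGe R ((2 : ℕ) : ℤ) (T.modelY x y) := by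
      refine T.vge_modelY h2 hu (T.vge_ψ h2 hu h.left (H.vge_cubicEval_of_vge_add h1)
        (by norm_num)) ((H.veq_of_vge_add h1).vge (by norm_num)) ?_
      rcases hm with ⟨-, h, -⟩ | ⟨-, h, -⟩ <;> exact h.mono (by push_cast; omega)
    obtain ⟨p, hp⟩ := h3.exists_mul_pow T.irreducible
    obtain ⟨q, hq⟩ := h4.exists_mul_pow T.irreducible
    refine ⟨p, q, T.hasCoordinates_some_iff.2 ⟨?_, hq.symm⟩⟩
    rw [map_add, ← hp, map_neg]
    ring

lemma hitsBeta_iff {x y : K} (h : W.toAffine.Nonsingular x y) (hM : 1 ≤ M) :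
    T.HitsBeta (.some x y h) ↔ VGe R 1 (T.sCoord x) := by
  have hϖ := T.veq_ϖ
  obtain ⟨ha1, ha2, m, ha4, hm⟩ := T.isIStar.valuations (K := K) T.irreducible
  have H := T.isStarCubic h2 hM
  constructor
  · rintro ⟨m, p, q, hpq⟩
    have key : algebraMap R K (T.ϖ ^ (m + 2) * p) = T.ϖK * T.sCoord x := by
      rcases hpq with ⟨-, hpq⟩ | ⟨-, hpq⟩ <;> exact (T.hasCoordinates_some_iff.1 hpq).1
    refine VGe.of_mul (k := m + 2) (a := T.ϖK) ?_ hϖ (by omega)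
    rw [← key]
    exact vge_of_dvd T.irreducible (dvd_mul_right _ p) (by push_cast; omega)
  · intro h1
    obtain ⟨k, hk, hk'⟩ := H.exists_vge_of_vge h1 (T.odd_of_veq_cubicEval h2 h.left)
    have hk1 : 1 ≤ k := by omega
    have hg := H.vge_cubicEval_of_vge hk1 hk hk'
    rcases hm with ⟨hm, h3, -⟩ | ⟨hm, h3, -⟩
    · have h4 : VGe R ((m + 2 : ℕ) : ℤ) (T.ϖK * T.sCoord x) :=
        (hϖ.vge le_rfl).mul hk (by push_cast; omega)
      have h5 : VGe R ((m + 2 : ℕ) : ℤ) (T.modelY x y) :=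
        T.vge_modelY h2 hu (T.vge_ψ h2 hu h.left hg (by push_cast; omega))
          (hk.mono (by push_cast; omega)) (h3.mono (by push_cast; omega))
      obtain ⟨p, hp⟩ := h4.exists_mul_pow T.irreducible
      obtain ⟨q, hq⟩ := h5.exists_mul_pow T.irreducible
      exact ⟨m, p, q, .inl ⟨hm, T.hasCoordinates_some_iff.2 ⟨hp.symm, hq.symm⟩⟩⟩
    · have h4 : VGe R ((m + 2 : ℕ) : ℤ) (T.ϖK * T.sCoord x) :=
        (hϖ.vge le_rfl).mul hk (by push_cast; omega)
      have h5 : VGe R ((m + 3 : ℕ) : ℤ) (T.modelY x y) :=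
        T.vge_modelY h2 hu (T.vge_ψ h2 hu h.left hg (by push_cast; omega))
          (hk.mono (by push_cast; omega)) (h3.mono (by push_cast; omega))
      obtain ⟨p, hp⟩ := h4.exists_mul_pow T.irreducible
      obtain ⟨q, hq⟩ := h5.exists_mul_pow T.irreducible
      exact ⟨m, p, q, .inr ⟨hm, T.hasCoordinates_some_iff.2 ⟨hp.symm, hq.symm⟩⟩⟩

/-- The singular point of the reduced curve is the common reduction of the points with integral
coordinate `S`: there both partial derivatives of the Weierstrass equation vanish modulo the maximal
ideal, while elsewhere `ψ = 2 y + a₁ x + a₃` is a unit or the point reduces to infinity. -/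
lemma hitsZero_iff [W.IsMinimal R] (hM : 1 ≤ M) (hr : VGe R 0 T.C.r) {x y : K}
    (h : W.toAffine.Nonsingular x y) :
    HitsZero R W (.some x y h) ↔ ¬ VGe R 0 (T.sCoord x) := by
  have two := veq_two (R := R) (K := K) h2
  have four := veq_four (R := R) (K := K) h2
  have hϖ := T.veq_ϖ
  have H := T.isStarCubic h2 hM
  have hx := T.x_eq x
  have i1 := integralModel_a₁_eq R W
  have i2 := integralModel_a₂_eq R W
  have i3 := integralModel_a₃_eq R W
  have i4 := integralModel_a₄_eq R W
  have v1 : VGe R 0 W.a₁ := i1 ▸ vge_algebraMap _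
  have v3 : VGe R 0 W.a₃ := i3 ▸ vge_algebraMap _
  constructor
  · intro hz hS
    obtain ⟨h4, hc4, _, _⟩ := H.exists_vge_c₄
    have hg : VGe R 0 (cubicEval T.cubic₂ T.cubic₄ T.cubic₆ (T.sCoord x)) := by
      have := (H.vge_cubicEval_sub hS).mono (m := 0) (by norm_num)
      have := this.add ((hS.pow 2 (k := 0) (by norm_num)).mul (hS.add (H.veq_c₂.vge le_rfl))
        (k := 0) (by norm_num))
      rwa [sub_add_cancel] at this
    have hψ := T.vge_ψ h2 hu h.left (n := 2) hg (by norm_num)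
    have vx : VGe R 0 x := by
      rw [hx]
      exact ((((hu.pow 2 rfl).mul hϖ rfl).vge le_rfl).mul hS (by norm_num)).add hr
    have vy : VGe R 0 y := by
      refine VGe.of_mul (k := 0) (a := 2) ?_ two (by norm_num)
      rw [show 2 * y = 2 * y + W.a₁ * x + W.a₃ - W.a₁ * x - W.a₃ by ring]
      exact ((hψ.mono (by norm_num)).sub (v1.mul vx (by norm_num))).sub v3
    have hd : VGe R 1 (W.a₁ * y - (3 * x ^ 2 + 2 * W.a₂ * x + W.a₄)) := by
      have e : 2 * (W.a₁ * y - (3 * x ^ 2 + 2 * W.a₂ * x + W.a₄)) =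
          W.a₁ * (2 * y + W.a₁ * x + W.a₃) - 2 * T.C.u ^ 4 * T.ϖK ^ 2 *
            (3 * T.sCoord x ^ 2 + 2 * T.cubic₂ * T.sCoord x + T.cubic₄) := by
        have e1 : 2 * (W.a₁ * y - (3 * x ^ 2 + 2 * W.a₂ * x + W.a₄)) =
            W.a₁ * (2 * y + W.a₁ * x + W.a₃) - (6 * x ^ 2 + W.b₂ * x + W.b₄) := by
          rw [b₂, b₄]; ring
        rw [e1, T.b₄_eq h2, T.b₂_eq h2]
        generalize T.sCoord x = S at *
        rw [hx]
        ring
      refine VGe.of_mul (k := 2) (a := 2) ?_ two (by norm_num)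
      rw [e]
      refine (v1.mul hψ (by norm_num)).sub (((((two.mul (hu.pow 4 rfl) rfl).mul (hϖ.pow 2 rfl)
        rfl).vge le_rfl)).mul (m := 0) ((VGe.add ?_ ?_).add (hc4.mono (by omega))) (by norm_num))
      · exact (vge_ofNat 3).mul (hS.pow 2 le_rfl) (by norm_num)
      · exact ((two.mul H.veq_c₂ rfl).vge le_rfl).mul hS (by norm_num)
    obtain ⟨a, ha⟩ := vx.exists_eq
    obtain ⟨b, hb⟩ := vy.exists_eq
    have hz' := ((Affine.nonsingular_iff' ..).1 (hz a b ha hb)).2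
    simp only [reduction, map_a₁, map_a₂, map_a₃, map_a₄] at hz'
    rcases hz' with hz' | hz'
    · refine hz' ?_
      rw [← ha, ← hb, ← i1, ← i2, ← i4] at hd
      have := vge_one_algebraMap (R := R) (K := K) (r := (integralModel R W).a₁ * b -
        (3 * a ^ 2 + 2 * (integralModel R W).a₂ * a + (integralModel R W).a₄))
      simp only [map_sub, map_add, map_mul, map_pow, map_ofNat] at this
      simpa using this.1 hd
    · refine hz' ?_
      rw [← ha, ← hb, ← i1, ← i3] at hψ
      have := vge_one_algebraMap (R := R) (K := K) (r := 2 * b + (integralModel R W).a₁ * a +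
        (integralModel R W).a₃)
      simp only [map_add, map_mul, map_ofNat] at this
      simpa using this.1 (hψ.mono (by norm_num))
  · intro hS a b ha hb
    rcases vge_or_veq (R := R) 0 (T.sCoord x) with hS' | ⟨n, hn, hS'⟩
    · exact absurd hS' hS
    have hxr : VEq R (n + 1) (x - T.C.r) := by
      rw [show x - T.C.r = T.C.u ^ 2 * T.ϖK * T.sCoord x by linear_combination hx]
      exact ((hu.pow 2 rfl).mul hϖ rfl).mul hS' (by push_cast; omega)
    have hn' := hxr.le ((ha ▸ vge_algebraMap a : VGe R 0 x).sub hr)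
    obtain rfl : n = -1 := by omega
    have hψ : VEq R 0 ((2 * y + W.a₁ * x + W.a₃) ^ 2) := by
      rw [T.sq_eq_cubicEval h2 h.left]
      exact (((four.mul (hu.pow 6 rfl) rfl).mul (hϖ.pow 3 rfl) rfl)).mul
        (H.veq_cubicEval_of_neg hS' hn) (by norm_num)
    refine (Affine.nonsingular_iff' ..).2 ⟨?_, .inr ?_⟩
    · refine Affine.Equation.map (residue R) ((Affine.map_equation _
        (IsFractionRing.injective R K) a b).1 ?_)
      rw [ha, hb]
      have := baseChange_integralModel_eq R W
      rw [baseChange] at this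
      change ((integralModel R W).map (algebraMap R K)).toAffine.Equation x y
      rw [this]
      exact h.left
    · have := veq_zero_algebraMap (R := R) (K := K) (r := (2 * b + (integralModel R W).a₁ * a +
        (integralModel R W).a₃) ^ 2)
      simp only [map_add, map_mul, map_pow, map_ofNat, ha, hb, i1, i3] at this
      simpa [reduction] using this.1 hψ

end IStarModel

end Components

/-! ### The local height attached to a model -/

namespace IStarModel

variable {R : Type*} [CommRing R] [IsDomain R] [IsDiscreteValuationRing R]
  {K : Type u} [Field K] [Algebra R K] [IsFractionRing R K]
  {W : WeierstrassCurve K} {M : ℕ} (T : IStarModel R W M)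

/-- The explicit local height on the points of a curve with a model of type `I_M^*`. -/
def height (P : W.toAffine.Point) : ℝ := starHeight R M T.cubic₂ (T.sCoord (xCoord P))

variable (hu : VEq R 0 (T.C.u : K)) (hr : VGe R 0 T.C.r)
include hu hr

lemma veq_sCoord_of_neg {x : K} {n : ℤ} (hx : VEq R n x) (hn : n < 0) :
    VEq R (n - 1) (T.sCoord x) := by
  refine VEq.div (n := n) (m := 1) ?_ ((hu.pow 2 rfl).mul T.veq_ϖ (by norm_num)) rfl
  rw [sub_eq_add_neg]
  exact hx.add (hr.neg.mono (by omega))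

omit hr in
lemma veq_x_sub {x : K} {n : ℤ} (hS : VEq R n (T.sCoord x)) : VEq R (n + 1) (x - T.C.r) := by
  rw [show x - T.C.r = T.C.u ^ 2 * T.ϖK * T.sCoord x by linear_combination T.x_eq x]
  exact ((hu.pow 2 rfl).mul T.veq_ϖ rfl).mul hS (by push_cast; omega)

omit hr in
lemma height_continuous (P Q : W.toAffine.Point) (h : VGe R 2 (xCoord Q - xCoord P)) :
    T.height Q = T.height P := by
  refine starHeight_congr ?_
  rw [sCoord, sCoord, ← sub_div, sub_sub_sub_cancel_right]
  exact h.div ((hu.pow 2 rfl).mul T.veq_ϖ rfl) (by norm_num)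

lemma abs_height_le (P : W.toAffine.Point) {N : ℤ} (h : VGe R (-N) (xCoord P)) :
    |T.height P| ≤ M + |(N : ℝ)| + 1 := by
  have h0 : (0 : ℝ) ≤ M := M.cast_nonneg
  have hN := abs_nonneg (N : ℝ)
  rw [abs_le, height]
  rcases vge_or_veq (R := R) 0 (T.sCoord (xCoord P)) with hS | ⟨n, hn, hS⟩
  · rw [starHeight, if_pos hS]
    push_cast
    split_ifs <;> constructor <;> linarith
  · rw [starHeight_of_veq hS hn]
    have h1 := (T.veq_x_sub hu hS).le (m := min (-N) 0)
      ((h.mono (min_le_left _ _)).sub (hr.mono (min_le_right _ _)))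
    have h2 : -n ≤ |N| + 1 := by
      rcases le_total (-N) 0 with h3 | h3
      · rw [min_eq_left h3] at h1
        have := le_abs_self N
        omega
      · rw [min_eq_right h3] at h1
        have := abs_nonneg N
        omega
    have h3 : -(n : ℝ) ≤ |(N : ℝ)| + 1 := by exact_mod_cast h2
    have h4 : (n : ℝ) < 0 := by exact_mod_cast hn
    push_cast
    constructor <;> linarith

variable [DecidableEq K] (h2 : (2 : ResidueField R) ≠ 0) (hM : 1 ≤ M)
include h2 hM

theorem isCanonicalLocalHeight_height :
    IsCanonicalLocalHeight R W fun P => T.height P.1 := by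
  -- Points whose `x`-coordinates agree modulo `ϖ²` have congruent `S`, so the same height.
  refine ⟨fun P ε hε => ⟨2, fun Q hQ _ => ?_⟩, fun N => ⟨M + |(N : ℝ)| + 1, fun P hP => ?_⟩,
    ⟨(M : ℝ) / 12 + 1 / 2, fun ε hε => ⟨0, fun P hP => ?_⟩⟩, fun ⟨P, hP0⟩ h => ?_⟩
  · rw [T.height_continuous hu P Q hQ, sub_self, abs_zero]
    exact hε
  · exact T.abs_height_le hu hr P.1 (N := N) (by rwa [VGe, neg_neg])
  · obtain ⟨k, hk⟩ := exists_veq (R := R) (a := xCoord P.1) (by rintro h; simp [h] at hP)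
    rw [hk, WithZero.exp_lt_exp] at hP
    rw [height, starHeight_of_veq (T.veq_sCoord_of_neg hu hr hk (by omega)) (by omega), hk.ord]
    push_cast
    ring_nf
    simpa using hε
  · match P, hP0, h with
    | .zero, hP0, h => exact absurd rfl hP0
    | .some x y hP, hP0, h =>
      simp only [xCoord, yCoord]
      have hψ : 2 * y + W.a₁ * x + W.a₃ ≠ 0 := fun h0 => h (two_smul_some_eq_zero h0)
      obtain ⟨x', y', hP', e, hx'⟩ := exists_two_smul_some hP hψ
      have hc := T.sq_eq_cubicEval h2 hP.left
      have hϖ := T.veq_ϖ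
      have hg : cubicEval T.cubic₂ T.cubic₄ T.cubic₆ (T.sCoord x) ≠ 0 := by
        intro h0
        rw [h0, mul_zero] at hc
        exact pow_ne_zero 2 hψ hc
      have hdup := (T.isStarCubic h2 hM).starHeight_duplication (veq_four h2) hg
        (T.odd_of_veq_cubicEval h2 hP.left) (T.odd_of_veq_cubicEval h2 hP'.left)
        (T.sCoord_duplication h2 hc hx')
      obtain ⟨s, hs⟩ := exists_veq (R := R) hg
      have hs' : VEq R (s + 3) ((2 * y + W.a₁ * x + W.a₃) ^ 2) := by
        rw [hc]
        exact (((veq_four h2).mul (hu.pow 6 rfl) rfl).mul (hϖ.pow 3 rfl) rfl).mul hs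
          (by push_cast; omega)
      have hΔ : VEq R (M + 6) W.Δ := by
        rw [T.Δ_eq]
        exact (hu.pow 12 rfl).mul (T.veq_Δ h2 hM) (by push_cast; omega)
      have hq : VEq R (2 * (s + 3) - (M + 6)) ((2 * y + W.a₁ * x + W.a₃) ^ 4 / W.Δ) := by
        rw [show (2 * y + W.a₁ * x + W.a₃) ^ 4 = ((2 * y + W.a₁ * x + W.a₃) ^ 2) ^ 2 by ring]
        exact (hs'.pow 2 rfl).div hΔ (by push_cast; omega)
      simp only [e]
      rw [height, height, xCoord, xCoord, hdup, hs.ord, hq.ord]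
      push_cast
      ring

omit [DecidableEq K] in
theorem height_of_mem_formalFiltration [W.IsMinimal R] (ν : ℕ) {P : W.toAffine.Point}
    (hP0 : P ≠ 0) (h : P ∈ W.formalFiltration R ν \ W.formalFiltration R (ν + 1)) :
    T.height P = (M : ℝ) / 12 + 1 / 2 + ν := by
  match P, hP0, h with
  | .zero, hP0, h => exact absurd rfl hP0
  | .some x y hP, hP0, ⟨h, h'⟩ =>
    have hodd {n : ℤ} (hS : VEq R n (T.sCoord x)) (hn : n < 0) : n % 2 = 1 := by
      have := T.odd_of_veq_cubicEval h2 hP.left _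
        ((T.isStarCubic h2 hM).veq_cubicEval_of_neg hS hn)
      rw [Int.odd_iff] at this
      omega
    have h' : mulVal R x < WithZero.exp (2 * ((ν : ℤ) + 1)) :=
      lt_of_not_ge fun h1 => h' (.inr h1)
    rw [height, xCoord]
    cases ν with
    | zero =>
      obtain ⟨n, hn, hS⟩ := (vge_or_veq (R := R) 0 (T.sCoord x)).resolve_left
        ((T.hitsZero_iff h2 hu hM hr hP).1 h)
      have h1 := hodd hS hn
      obtain rfl : n = -1 := by
        have h3 := T.veq_x_sub hu hS
        by_contra hne
        have h4 : VEq R (n + 1) x := by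
          have := h3.add (hr.mono (by omega))
          rwa [sub_add_cancel] at this
        rw [h4, WithZero.exp_lt_exp] at h'
        push_cast at h'
        omega
      rw [starHeight_of_veq hS hn]
      push_cast
      ring
    | succ ν =>
      have h : WithZero.exp (2 * ((ν : ℤ) + 1)) ≤ mulVal R x :=
        h.resolve_left (Affine.Point.some_ne_zero hP)
      obtain ⟨k, hk⟩ := exists_veq (R := R) (a := x) (by rintro rfl; simp at h)
      rw [hk, WithZero.exp_lt_exp] at h'
      rw [hk, WithZero.exp_le_exp] at h
      push_cast at h'
      have hS := T.veq_sCoord_of_neg hu hr hk (by omega)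
      have h1 := hodd hS (by omega)
      obtain rfl : k = -(2 * ((ν : ℤ) + 1)) := by omega
      rw [starHeight_of_veq hS (by omega)]
      push_cast
      ring

omit [DecidableEq K] hr in
theorem height_of_hitsAlpha {P : W.toAffine.Point} (h : T.HitsAlpha P) :
    T.height P = (M : ℝ) / 12 := by
  match P, h with
  | .zero, ⟨_, _, h⟩ => exact h.elim
  | .some x y hP, h =>
    have h1 := (T.hitsAlpha_iff h2 hu hP hM).1 h
    exact (starHeight_of_vge_add ((T.isStarCubic h2 hM).veq_c₂.vge le_rfl) h1).trans
      (by rw [Int.cast_natCast])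

omit [DecidableEq K] hr in
theorem height_of_hitsBeta {P : W.toAffine.Point} (h : T.HitsBeta P) :
    T.height P = -(M : ℝ) / 24 := by
  match P, h with
  | .zero, ⟨_, _, _, h⟩ => exact (h.elim And.right And.right).elim
  | .some x y hP, h =>
    have h1 := (T.hitsBeta_iff h2 hu hP hM).1 h
    exact (starHeight_of_vge (T.isStarCubic h2 hM).veq_c₂ h1).trans (by rw [Int.cast_natCast])

omit [DecidableEq K] in
theorem hits_exactly_one [W.IsMinimal R] (P : W.toAffine.Point) :
    (W.HitsZero R P ∨ T.HitsAlpha P ∨ T.HitsBeta P) ∧ ¬ (W.HitsZero R P ∧ T.HitsAlpha P) ∧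
      ¬ (W.HitsZero R P ∧ T.HitsBeta P) ∧ ¬ (T.HitsAlpha P ∧ T.HitsBeta P) := by
  match P with
  | .zero =>
    have ha : ¬ T.HitsAlpha .zero := fun ⟨_, _, h⟩ => h
    have hb : ¬ T.HitsBeta .zero := fun ⟨_, _, _, h⟩ => h.elim And.right And.right
    exact ⟨.inl trivial, fun h => ha h.2, fun h => hb h.2, fun h => hb h.2⟩
  | .some x y hP =>
    have H := T.isStarCubic h2 hM
    rw [T.hitsZero_iff h2 hu hM hr hP, T.hitsAlpha_iff h2 hu hP hM, T.hitsBeta_iff h2 hu hP hM]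
    refine ⟨?_, fun h => h.1 ((H.veq_of_vge_add h.2).vge le_rfl),
      fun h => h.1 (h.2.mono zero_le_one), fun h => ?_⟩
    · by_cases hS : VGe R 0 (T.sCoord x)
      · exact .inr (H.vge_add_or_vge hS (T.odd_of_veq_cubicEval h2 hP.left))
      · exact .inl hS
    · have := (H.veq_of_vge_add h.1).le h.2
      omega

end IStarModel

/-! ### Uniqueness of the canonical local height -/

section Uniqueness

variable {R : Type*} [CommRing R] [IsDomain R] [IsDiscreteValuationRing R]
  {K : Type u} [Field K] [Algebra R K] [IsFractionRing R K]

/-- By Hensel's lemma `1 + z` is a square if `v(z) ≥ 1`. -/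
lemma exists_sq_eq_one_add [IsAdicComplete (maximalIdeal R) R] (h2 : (2 : ResidueField R) ≠ 0)
    {z : K} (hz : VGe R 1 z) : ∃ w : K, w ^ 2 = 1 + z ∧ VEq R 0 w := by
  obtain ⟨r, rfl⟩ := (hz.mono zero_le_one).exists_eq
  have hr : residue R r = 0 := vge_one_algebraMap.1 hz
  have hr' : r ∈ maximalIdeal R := (residue_eq_zero_iff _).1 hr
  obtain ⟨w, hw, hw'⟩ := HenselianRing.is_henselian (I := maximalIdeal R)
    (Polynomial.X ^ 2 - Polynomial.C (1 + r)) (Polynomial.monic_X_pow_sub_C _ two_ne_zero) 1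
    (by simpa using hr') (by
      simp only [Polynomial.derivative_sub, Polynomial.derivative_X_pow, Polynomial.derivative_C,
        sub_zero, Polynomial.eval_mul, Polynomial.eval_pow, Polynomial.eval_X, one_pow, mul_one]
      refine IsUnit.map _ ((residue_ne_zero_iff_isUnit _).1 ?_)
      rw [Polynomial.eval_C, Nat.cast_ofNat, map_ofNat]
      exact h2)
  refine ⟨algebraMap R K w, ?_, veq_zero_algebraMap.2 ?_⟩
  · have : w ^ 2 = 1 + r := by simpa [sub_eq_zero, Polynomial.IsRoot] using hw
    rw [← map_pow, this, map_add, map_one]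
  · have := (residue_eq_zero_iff _).2 hw'
    rw [map_sub, map_one, sub_eq_zero] at this
    rw [this]
    exact one_ne_zero

variable {W : WeierstrassCurve K}

lemma vge_b [W.IsIntegral R] : VGe R 0 W.b₂ ∧ VGe R 0 W.b₄ ∧ VGe R 0 W.b₆ ∧ VGe R 0 W.b₈ :=
  ⟨integralModel_b₂_eq R W ▸ vge_algebraMap _, integralModel_b₄_eq R W ▸ vge_algebraMap _,
    integralModel_b₆_eq R W ▸ vge_algebraMap _, integralModel_b₈_eq R W ▸ vge_algebraMap _⟩

lemma nonsingular_of_sq [W.IsElliptic] (h4 : (4 : K) ≠ 0) {x y : K}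
    (h : (2 * y + W.a₁ * x + W.a₃) ^ 2 = 4 * x ^ 3 + W.b₂ * x ^ 2 + 2 * W.b₄ * x + W.b₆) :
    W.toAffine.Nonsingular x y := by
  rw [← Affine.equation_iff_nonsingular, Affine.equation_iff]
  refine mul_left_cancel₀ h4 ?_
  simp only [b₂, b₄, b₆] at h
  linear_combination h

variable [DecidableEq K] [IsAdicComplete (maximalIdeal R) R]

/-- There are points arbitrarily close to `0` whose double is as close to `0`. -/
lemma exists_point_near_zero (h2 : (2 : ResidueField R) ≠ 0) [W.IsElliptic] [W.IsIntegral R]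
    (N : ℤ) : ∃ P : W.toAffine.Point, P ≠ 0 ∧ 2 • P ≠ 0 ∧
      WithZero.exp N < mulVal R (xCoord P) ∧ WithZero.exp N < mulVal R (xCoord (2 • P)) := by
  obtain ⟨ϖ, hϖ⟩ := IsDiscreteValuationRing.exists_irreducible R
  have two := veq_two (R := R) (K := K) h2
  have four := veq_four (R := R) (K := K) h2
  obtain ⟨v2, v4, v6, v8⟩ := vge_b (R := R) (W := W)
  obtain ⟨n, hn, hN⟩ : ∃ n : ℕ, 1 ≤ n ∧ N < 2 * n := ⟨N.natAbs + 1, by omega, by omega⟩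
  obtain ⟨c, hc⟩ : ∃ c : K, VEq R (-n) c :=
    ⟨_, ((veq_uniformizer (K := K) hϖ).pow n rfl).inv (by omega)⟩
  -- The point has `x = c²`, and `4 x³ + b₂ x² + 2 b₄ x + b₆ = (2 c³)² (1 + z)` with `v(z) ≥ 1`.
  have hx : VEq R (-(2 * n)) (c ^ 2) := hc.pow 2 (by push_cast; omega)
  obtain ⟨w, hw, hw0⟩ := exists_sq_eq_one_add h2 (R := R) (K := K)
    (z := (W.b₂ * (c ^ 2) ^ 2 + 2 * W.b₄ * c ^ 2 + W.b₆) / (4 * (c ^ 2) ^ 3)) (by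
      refine VGe.div (n := -(4 * n)) (VGe.add (VGe.add ?_ ?_) (v6.mono (by omega)))
        (four.mul (hx.pow 3 rfl) rfl) (by push_cast; omega)
      · exact v2.mul ((hx.pow 2 rfl).vge le_rfl) (by push_cast; omega)
      · exact ((two.vge le_rfl).mul v4 le_rfl).mul (hx.vge le_rfl) (by push_cast; omega))
  have hψ : (2 * c ^ 3 * w) ^ 2 =
      4 * (c ^ 2) ^ 3 + W.b₂ * (c ^ 2) ^ 2 + 2 * W.b₄ * c ^ 2 + W.b₆ := by
    have h5 := (four.mul (hx.pow 3 rfl) rfl).ne_zero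
    rw [show (2 * c ^ 3 * w) ^ 2 = 4 * (c ^ 2) ^ 3 * w ^ 2 by ring, hw, mul_add,
      mul_div_cancel₀ _ h5]
    ring
  have hψ' : VEq R (-(6 * n)) ((2 * c ^ 3 * w) ^ 2) :=
    ((two.mul (hc.pow 3 rfl) rfl).mul hw0 rfl).pow 2 (by push_cast; omega)
  generalize hψ₀ : 2 * c ^ 3 * w = ψ at *
  generalize c ^ 2 = x at *
  obtain ⟨y, hy⟩ : ∃ y, 2 * y + W.a₁ * x + W.a₃ = ψ :=
    ⟨(ψ - W.a₁ * x - W.a₃) / 2, by rw [mul_div_cancel₀ _ two.ne_zero]; ring⟩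
  have hP := nonsingular_of_sq four.ne_zero (hy ▸ hψ : (2 * y + W.a₁ * x + W.a₃) ^ 2 = _)
  obtain ⟨x', y', hP', e, hx'⟩ := exists_two_smul_some hP
    (hy ▸ (pow_ne_zero_iff two_ne_zero).1 hψ'.ne_zero)
  refine ⟨.some x y hP, Affine.Point.some_ne_zero hP, e ▸ Affine.Point.some_ne_zero hP', ?_, ?_⟩
  · rw [xCoord, hx, WithZero.exp_lt_exp]
    omega
  · have h6 : VEq R (-(8 * n)) (x ^ 4 - W.b₄ * x ^ 2 - 2 * W.b₆ * x - W.b₈) := by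
      rw [show x ^ 4 - W.b₄ * x ^ 2 - 2 * W.b₆ * x - W.b₈ =
        x ^ 4 + -(W.b₄ * x ^ 2 + 2 * W.b₆ * x + W.b₈) by ring]
      refine (hx.pow 4 (by push_cast; omega)).add (VGe.neg (VGe.add (VGe.add ?_ ?_)
        (v8.mono (by omega))))
      · exact v4.mul ((hx.pow 2 rfl).vge le_rfl) (by push_cast; omega)
      · exact ((two.vge le_rfl).mul v6 le_rfl).mul (hx.vge le_rfl) (by push_cast; omega)
    rw [← hx', hy, mul_comm x'] at h6
    have h7 := h6.of_mul hψ' rfl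
    rw [e, xCoord, h7, WithZero.exp_lt_exp]
    omega

/-- A point of order two is a limit of points whose doubles tend to `0`. With
`φ = 4 x³ + b₂ x² + 2 b₄ x + b₆` and `D = φ'(x₀)`, the value of `φ` at `x₀ + D τ²` is
`D² τ² (1 + O(τ²))`, hence a square when `τ` is small. -/
lemma exists_point_near_two_torsion (h2 : (2 : ResidueField R) ≠ 0) [W.IsElliptic]
    [W.IsIntegral R] {x₀ y₀ : K} (hP₀ : W.toAffine.Nonsingular x₀ y₀)
    (h0 : 2 * y₀ + W.a₁ * x₀ + W.a₃ = 0) (N : ℤ) :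
    ∃ P : W.toAffine.Point, P ≠ 0 ∧ 2 • P ≠ 0 ∧
      mulVal R (xCoord P - x₀) ≤ WithZero.exp (-N) ∧ mulVal R (yCoord P - y₀) ≤ WithZero.exp (-N) ∧
      WithZero.exp N < mulVal R (xCoord (2 • P)) := by
  obtain ⟨ϖ, hϖ⟩ := IsDiscreteValuationRing.exists_irreducible R
  have two := veq_two (R := R) (K := K) h2
  have four := veq_four (R := R) (K := K) h2
  obtain ⟨v2, v4, v6, v8⟩ := vge_b (R := R) (W := W)
  have hφ₀ := sq_two_mul_y_add hP₀.left
  rw [h0, zero_pow two_ne_zero] at hφ₀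
  have hx₀ : VGe R 0 x₀ := by
    rcases vge_or_veq (R := R) 0 x₀ with h | ⟨n, hn, h⟩
    · exact h
    · refine absurd hφ₀.symm (VEq.ne_zero (R := R) (n := 3 * n) ?_)
      rw [add_assoc, add_assoc]
      refine (four.mul (h.pow 3 rfl) (by push_cast; omega)).add (VGe.add ?_ (VGe.add ?_
        (v6.mono (by omega))))
      · exact v2.mul ((h.pow 2 rfl).vge le_rfl) (by push_cast; omega)
      · exact ((two.vge le_rfl).mul v4 le_rfl).mul (h.vge le_rfl) (by push_cast; omega)
  obtain ⟨D, hD⟩ : ∃ D, D = 12 * x₀ ^ 2 + 2 * W.b₂ * x₀ + 2 * W.b₄ := ⟨_, rfl⟩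
  have hD0 : D ≠ 0 := by
    intro h
    rcases ((Affine.nonsingular_iff' ..).1 hP₀).2 with h' | h'
    · refine h' (mul_left_cancel₀ four.ne_zero ?_)
      rw [hD, b₂, b₄] at h
      linear_combination -h + 2 * W.a₁ * h0
    · exact h' h0
  obtain ⟨k, hk⟩ := exists_veq (R := R) hD0
  have hDi : VGe R 0 D := by
    rw [hD]
    refine VGe.add (VGe.add ?_ ?_) ((two.vge le_rfl).mul v4 (by norm_num))
    · exact (vge_ofNat 12).mul (hx₀.pow 2 le_rfl) (by norm_num)
    · exact ((two.vge le_rfl).mul v2 le_rfl).mul hx₀ (by norm_num)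
  have hk0 := hk.le hDi
  obtain ⟨n, hn, hN⟩ : ∃ n : ℕ, 1 ≤ n ∧ N ≤ n := ⟨N.natAbs + 1, by omega, by omega⟩
  obtain ⟨τ, hτ⟩ : ∃ τ : K, VEq R n τ := ⟨_, (veq_uniformizer (K := K) hϖ).pow n (by omega)⟩
  have hτ2 := (hτ.pow 2 rfl).vge le_rfl
  obtain ⟨w, hw, hw0⟩ := exists_sq_eq_one_add h2 (R := R) (K := K)
    (z := (12 * x₀ + W.b₂) * τ ^ 2 + 4 * D * (τ ^ 2) ^ 2) (by
      refine VGe.add (VGe.mul (n := 0) (VGe.add ?_ v2) hτ2 (by push_cast; omega)) ?_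
      · exact (vge_ofNat 12).mul hx₀ (by norm_num)
      · exact ((four.vge le_rfl).mul hDi le_rfl).mul (hτ2.pow 2 le_rfl) (by push_cast; omega))
  have hψ : (D * τ * w) ^ 2 = 4 * (x₀ + D * τ ^ 2) ^ 3 + W.b₂ * (x₀ + D * τ ^ 2) ^ 2 +
      2 * W.b₄ * (x₀ + D * τ ^ 2) + W.b₆ := by
    linear_combination D ^ 2 * τ ^ 2 * hw + hφ₀ + D * τ ^ 2 * hD
  have hDτ : VGe R (2 * n) (D * τ ^ 2) := hDi.mul hτ2 (by push_cast; omega)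
  have hψ' : VEq R (k + n) (D * τ * w) := (hk.mul hτ rfl).mul hw0 (by omega)
  have hd : VEq R k (D * (1 + ((24 * x₀ + 2 * W.b₂) * τ ^ 2 + 12 * D * (τ ^ 2) ^ 2))) := by
    refine hk.mul (veq_one.add (VGe.add (VGe.mul (n := 0) (VGe.add ?_ ?_) hτ2 ?_) ?_)) (by omega)
    · exact (vge_ofNat 24).mul hx₀ (by norm_num)
    · exact (two.vge le_rfl).mul v2 (by norm_num)
    · push_cast; omega
    · exact ((vge_ofNat 12).mul hDi le_rfl).mul (hτ2.pow 2 le_rfl) (by push_cast; omega)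
  have hd' : D * (1 + ((24 * x₀ + 2 * W.b₂) * τ ^ 2 + 12 * D * (τ ^ 2) ^ 2)) =
      12 * (x₀ + D * τ ^ 2) ^ 2 + 2 * W.b₂ * (x₀ + D * τ ^ 2) + 2 * W.b₄ := by
    linear_combination hD
  rw [hd'] at hd
  generalize hψ₀ : D * τ * w = ψ at *
  obtain ⟨x, hx⟩ : ∃ x, x = x₀ + D * τ ^ 2 := ⟨_, rfl⟩
  rw [← hx] at hψ hd
  have hxx : VGe R (2 * n) (x - x₀) := by rwa [hx, add_sub_cancel_left]
  have hxi : VGe R 0 x := hx ▸ hx₀.add (hDτ.mono (by omega))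
  obtain ⟨y, hy⟩ : ∃ y, 2 * y + W.a₁ * x + W.a₃ = ψ :=
    ⟨(ψ - W.a₁ * x - W.a₃) / 2, by rw [mul_div_cancel₀ _ two.ne_zero]; ring⟩
  have hyy : VGe R n (y - y₀) := by
    refine VGe.of_mul (a := 2) (k := n) ?_ two (by omega)
    rw [show 2 * (y - y₀) = ψ - W.a₁ * (x - x₀) by linear_combination hy - h0]
    exact (hψ'.vge (by omega)).sub ((integralModel_a₁_eq R W ▸ vge_algebraMap _ :
      VGe R 0 W.a₁).mul hxx (by omega))
  have hP := nonsingular_of_sq four.ne_zero (hy ▸ hψ : (2 * y + W.a₁ * x + W.a₃) ^ 2 = _)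
  obtain ⟨x', y', hP', e, hx'⟩ := exists_two_smul_some hP (hy ▸ hψ'.ne_zero)
  refine ⟨.some x y hP, Affine.Point.some_ne_zero hP, e ▸ Affine.Point.some_ne_zero hP',
    hxx.mono (by omega), hyy.mono (by omega), ?_⟩
  -- The numerator of the duplication formula is `φ'² / 16` up to a multiple of `φ`.
  have h6 : VEq R (2 * k) (4 ^ 2 * (x ^ 4 - W.b₄ * x ^ 2 - 2 * W.b₆ * x - W.b₈)) := by
    rw [show 4 ^ 2 * (x ^ 4 - W.b₄ * x ^ 2 - 2 * W.b₆ * x - W.b₈) =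
      (12 * x ^ 2 + 2 * W.b₂ * x + 2 * W.b₄) ^ 2 + -(ψ ^ 2 * (4 * W.b₂ + 32 * x)) by
        rw [hψ]; linear_combination -4 * W.b_relation]
    refine (hd.pow 2 (by push_cast; omega)).add (VGe.neg (VGe.mul ((hψ'.pow 2 rfl).vge le_rfl)
      (m := 0) (VGe.add ?_ ?_) (by push_cast; omega)))
    · exact (four.vge le_rfl).mul v2 (by norm_num)
    · exact (vge_ofNat 32).mul hxi (by norm_num)
  have h7 := h6.of_mul (four.pow 2 rfl) rfl
  rw [← hx', hy, mul_comm x'] at h7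
  have h8 := h7.of_mul (hψ'.pow 2 rfl) rfl
  rw [e, xCoord, h8, WithZero.exp_lt_exp]
  push_cast
  omega

lemma eq_zero_of_forall_abs_lt {a : ℝ} (h : ∀ ε > 0, |a| < ε) : a = 0 := by
  by_contra ha
  exact lt_irrefl _ (h _ (abs_pos.2 ha))

/-- The canonical local height is unique. The difference `g` of two of them is bounded and satisfies
`g(2P) = 4 g(P)`. Letting `P` tend to `0`, its limit at `0` is `0`; letting `P` tend to a point of
order two, `g` vanishes there; so a bound `B` for `|g|` can be replaced by `B / 4`. -/
theorem IsCanonicalLocalHeight.unique (h2 : (2 : ResidueField R) ≠ 0) [W.IsElliptic]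
    [W.IsIntegral R] {lam₁ lam₂ : {P : W.toAffine.Point // P ≠ 0} → ℝ}
    (h₁ : IsCanonicalLocalHeight R W lam₁) (h₂ : IsCanonicalLocalHeight R W lam₂) :
    lam₁ = lam₂ := by
  obtain ⟨g, hg⟩ : ∃ g, g = fun P => lam₁ P - lam₂ P := ⟨_, rfl⟩
  have hdup (P : {P : W.toAffine.Point // P ≠ 0}) (h : 2 • P.1 ≠ 0) :
      g ⟨2 • P.1, h⟩ = 4 * g P := by
    simp only [hg, h₁.duplication P h, h₂.duplication P h]
    ring
  have hcont (P) (ε : ℝ) (hε : 0 < ε) : ∃ N : ℤ, ∀ Q : {P : W.toAffine.Point // P ≠ 0},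
      mulVal R (xCoord Q.1 - xCoord P.1) ≤ WithZero.exp (-N) →
      mulVal R (yCoord Q.1 - yCoord P.1) ≤ WithZero.exp (-N) → |g Q - g P| < ε := by
    obtain ⟨N₁, hN₁⟩ := h₁.continuous P (ε / 2) (half_pos hε)
    obtain ⟨N₂, hN₂⟩ := h₂.continuous P (ε / 2) (half_pos hε)
    refine ⟨max N₁ N₂, fun Q hx hy => ?_⟩
    have l1 := WithZero.exp_le_exp.2 (neg_le_neg (le_max_left N₁ N₂))
    have l2 := WithZero.exp_le_exp.2 (neg_le_neg (le_max_right N₁ N₂))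
    have e1 := hN₁ Q (hx.trans l1) (hy.trans l1)
    have e2 := hN₂ Q (hx.trans l2) (hy.trans l2)
    rw [abs_lt] at *
    simp only [hg]
    constructor <;> linarith
  obtain ⟨l, hl⟩ : ∃ l : ℝ, ∀ ε : ℝ, 0 < ε → ∃ N : ℤ, ∀ P : {P : W.toAffine.Point // P ≠ 0},
      WithZero.exp N < mulVal R (xCoord P.1) → |g P - l| < ε := by
    obtain ⟨l₁, hl₁⟩ := h₁.limit
    obtain ⟨l₂, hl₂⟩ := h₂.limit
    refine ⟨l₁ - l₂, fun ε hε => ?_⟩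
    obtain ⟨N₁, hN₁⟩ := hl₁ (ε / 2) (half_pos hε)
    obtain ⟨N₂, hN₂⟩ := hl₂ (ε / 2) (half_pos hε)
    refine ⟨max N₁ N₂, fun P hP => ?_⟩
    have e1 := hN₁ P ((WithZero.exp_le_exp.2 (le_max_left N₁ N₂)).trans_lt hP)
    have e2 := hN₂ P ((WithZero.exp_le_exp.2 (le_max_right N₁ N₂)).trans_lt hP)
    rw [abs_lt] at *
    simp only [hg]
    constructor <;> linarith
  obtain rfl : l = 0 := eq_zero_of_forall_abs_lt fun ε hε => by
    obtain ⟨N, hN⟩ := hl (ε / 2) (half_pos hε)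
    obtain ⟨P, hP, hP2, hx, hx2⟩ := exists_point_near_zero (W := W) h2 (R := R) N
    have e1 := hN ⟨P, hP⟩ hx
    have e2 := hN ⟨2 • P, hP2⟩ hx2
    rw [hdup ⟨P, hP⟩ hP2] at e2
    rw [abs_lt] at *
    constructor <;> linarith
  have htors (P : {P : W.toAffine.Point // P ≠ 0}) (h : 2 • P.1 = 0) : g P = 0 := by
    match P, h with
    | ⟨.zero, hP⟩, _ => exact absurd rfl hP
    | ⟨.some x y hP, hP0⟩, h =>
      have hψ : 2 * y + W.a₁ * x + W.a₃ = 0 := by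
        by_contra hψ
        obtain ⟨x', y', hP', e, -⟩ := exists_two_smul_some hP hψ
        exact Affine.Point.some_ne_zero hP' (e ▸ h)
      refine eq_zero_of_forall_abs_lt fun ε hε => ?_
      obtain ⟨N₁, hN₁⟩ := hcont ⟨.some x y hP, hP0⟩ (ε / 2) (half_pos hε)
      obtain ⟨N₂, hN₂⟩ := hl (ε / 2) (half_pos hε)
      obtain ⟨Q, hQ, hQ2, hx, hy, hx2⟩ :=
        exists_point_near_two_torsion h2 (R := R) hP hψ (max N₁ N₂)
      have l1 := WithZero.exp_le_exp.2 (neg_le_neg (le_max_left N₁ N₂))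
      have e1 := hN₁ ⟨Q, hQ⟩ (hx.trans l1) (hy.trans l1)
      have e2 := hN₂ ⟨2 • Q, hQ2⟩ ((WithZero.exp_le_exp.2 (le_max_right N₁ N₂)).trans_lt hx2)
      rw [hdup ⟨Q, hQ⟩ hQ2] at e2
      rw [abs_lt] at *
      constructor <;> linarith
  obtain ⟨B, hB⟩ : ∃ B : ℝ, ∀ P, |g P| ≤ B := by
    obtain ⟨N, hN⟩ := hl 1 one_pos
    obtain ⟨B₁, hB₁⟩ := h₁.bounded N
    obtain ⟨B₂, hB₂⟩ := h₂.bounded N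
    refine ⟨max 1 (B₁ + B₂), fun P => ?_⟩
    rcases le_or_gt (mulVal R (xCoord P.1)) (WithZero.exp N) with h | h
    · refine le_max_of_le_right ?_
      rw [hg]
      exact (abs_sub _ _).trans (add_le_add (hB₁ P h) (hB₂ P h))
    · exact le_max_of_le_left (by simpa using (hN P h).le)
  have hB' (n : ℕ) : ∀ P, |g P| ≤ B * (1 / 4) ^ n := by
    induction n with
    | zero => simpa using hB
    | succ n ih =>
      intro P
      by_cases h : 2 • P.1 = 0
      · rw [htors P h, abs_zero]
        exact mul_nonneg ((abs_nonneg _).trans (hB P)) (by positivity)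
      · have := ih ⟨2 • P.1, h⟩
        rw [hdup P h, abs_mul, abs_of_pos four_pos] at this
        rw [pow_succ]
        linarith
  funext P
  rw [← sub_eq_zero]
  have h0 : |g P| ≤ 0 := by
    refine ge_of_tendsto' (x := Filter.atTop) (f := fun n : ℕ => B * (1 / 4 : ℝ) ^ n) ?_
      fun n => hB' n P
    simpa using (tendsto_pow_atTop_nhds_zero_of_lt_one (by norm_num : (0 : ℝ) ≤ 1 / 4)
      (by norm_num)).const_mul B
  simpa [hg] using h0

end Uniqueness

/-! ### Existence of a model of type `I_M^*` -/

section Existence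

/-- The change of variables that moves the origin to `x = r`, completes the square and scales by
`u`. -/
def squareChange {F : Type*} [Field F] (W : WeierstrassCurve F) (u : Fˣ) (r : F) :
    VariableChange F :=
  ⟨u, r, -W.a₁ / 2, -(W.a₃ + r * W.a₁) / 2⟩

lemma squareChange_smul {F : Type*} [Field F] (W : WeierstrassCurve F) (h2 : (2 : F) ≠ 0) (u : Fˣ)
    (r : F) : W.squareChange u r • W =
      ⟨0, (W.b₂ + 12 * r) / (4 * u ^ 2), 0, (W.b₄ + r * W.b₂ + 6 * r ^ 2) / (2 * u ^ 4),
        (W.b₆ + 2 * r * W.b₄ + r ^ 2 * W.b₂ + 4 * r ^ 3) / (4 * u ^ 6)⟩ := by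
  have h4 : (4 : F) ≠ 0 := by
    rw [show (4 : F) = 2 * 2 by norm_num]
    exact mul_ne_zero h2 h2
  have hu := u.ne_zero
  rw [variableChange_def]
  simp only [squareChange, b₂, b₄, b₆, Units.val_inv_eq_inv_val]
  ext <;> dsimp only <;> field_simp <;> ring

variable {R : Type*} [CommRing R] [IsDomain R] [IsDiscreteValuationRing R]
  {K : Type u} [Field K] [Algebra R K] [IsFractionRing R K] {W : WeierstrassCurve K}

lemma Δ_mul_j {F : Type*} [Field F] (W : WeierstrassCurve F) [W.IsElliptic] :
    W.Δ * W.j = W.c₄ ^ 3 := by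
  rw [j, ← coe_Δ', ← mul_assoc, Units.mul_inv, one_mul]

/-- If the reduction is potentially multiplicative, then the `j`-invariant is not integral. -/
lemma HasPotentiallyMultiplicativeReduction.not_vge_j [W.IsElliptic]
    (h : W.HasPotentiallyMultiplicativeReduction R) : ¬ VGe R 0 W.j := by
  intro hj
  obtain ⟨r, hr⟩ := hj.exists_eq
  obtain ⟨L, _, _, _, _, _, _, _, C, hC⟩ := h
  have e : algebraMap (integralClosure R L) L (algebraMap R (integralClosure R L) r) =
      (C • W.map (algebraMap K L)).j := by
    rw [variableChange_j, map_j, ← hr, ← IsScalarTower.algebraMap_apply,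
      ← IsScalarTower.algebraMap_apply]
  have h1 := congrArg (mulVal (integralClosure R L)) (Δ_mul_j (C • W.map (algebraMap K L)))
  rw [← e, map_mul, map_pow, mulVal, hC.multiplicativeReduction, one_pow] at h1
  refine absurd h1 (ne_of_lt ?_)
  exact lt_of_le_of_lt (mul_le_of_le_one_right' (IsDedekindDomain.HeightOneSpectrum.valuation_le_one
    _ _)) hC.badReduction

/-- Otherwise `y² = x³ - c₄ / (48 ϖ⁴) x - c₆ / (864 ϖ⁶)` would be an integral equation with smaller
discriminant. -/
lemma not_vge_c_of_isMinimal [W.IsMinimal R] (h2 : (2 : ResidueField R) ≠ 0)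
    (h3 : (3 : ResidueField R) ≠ 0) (hΔ : W.Δ ≠ 0) (h4 : VGe R 4 W.c₄) : ¬ VGe R 6 W.c₆ := by
  intro h6
  have two := veq_two (R := R) (K := K) h2
  have three := veq_three (R := R) (K := K) h3
  obtain ⟨ϖ, hϖ⟩ := IsDiscreteValuationRing.exists_irreducible R
  have hτ := veq_uniformizer (K := K) hϖ
  set C := W.squareChange (Units.mk0 _ hτ.ne_zero) (-W.b₂ / 12) with hC
  have n48 : VEq R 0 (48 : K) := by
    rw [show (48 : K) = 2 ^ 4 * 3 by norm_num]
    exact (two.pow 4 rfl).mul three (by norm_num)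
  have n864 : VEq R 0 (864 : K) := by
    rw [show (864 : K) = 2 ^ 5 * 3 ^ 3 by norm_num]
    exact (two.pow 5 rfl).mul (three.pow 3 rfl) (by norm_num)
  have n12 : (12 : K) ≠ 0 := by
    rw [show (12 : K) = 2 ^ 2 * 3 by norm_num]
    exact mul_ne_zero (pow_ne_zero _ two.ne_zero) three.ne_zero
  have e : C • W = ⟨0, 0, 0, -W.c₄ / (48 * algebraMap R K ϖ ^ 4),
      -W.c₆ / (864 * algebraMap R K ϖ ^ 6)⟩ := by
    have := n48.ne_zero
    have := n864.ne_zero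
    have := two.ne_zero
    have := (veq_four (R := R) (K := K) h2).ne_zero
    have := hτ.ne_zero
    rw [hC, squareChange_smul _ two.ne_zero, c₄, c₆, Units.val_mk0]
    ext <;> dsimp only
    · rw [mul_div_cancel₀ _ n12, add_neg_cancel, zero_div]
    · field_simp
      ring
    · field_simp
      ring
  have hint : IsIntegral R (C • W) := by
    rw [e]
    exact isIntegral_of_exists_lift R ⟨0, map_zero _⟩ ⟨0, map_zero _⟩ ⟨0, map_zero _⟩
      (h4.neg.div (n48.mul (hτ.pow 4 rfl) rfl) (by norm_num)).exists_eq
      (h6.neg.div (n864.mul (hτ.pow 6 rfl) rfl) (by norm_num)).exists_eq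
  obtain ⟨d, hd⟩ := exists_veq (R := R) hΔ
  have hd' : VEq R (d - 12) (C • W).Δ := by
    have hu : VEq R 1 (C.u : K) := hτ
    rw [variableChange_Δ, Units.val_inv_eq_inv_val]
    exact ((hu.inv rfl).pow 12 rfl).mul hd (by push_cast; omega)
  have hle : (valuation_Δ_aux R ((1 : VariableChange K) • W)).1 <
      (valuation_Δ_aux R (C • W)).1 := by
    rw [one_smul, valuation_Δ_aux_eq_of_isIntegral, valuation_Δ_aux_eq_of_isIntegral]
    change mulVal R _ < mulVal R _
    rw [hd, hd', WithZero.exp_lt_exp]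
    omega
  exact absurd (IsMinimal.val_Δ_maximal.2 hint hle.le) (not_le_of_gt hle)

/-- The invariants of a minimal equation with additive, potentially multiplicative reduction. As
`3 v(c₄) < v(Δ)` and `c₄³ - c₆² = 1728 Δ`, the valuations of `c₄` and `c₆` are `2 e` and `3 e`, and
`e = 1` by minimality. -/
lemma exists_valuations_of_additive [W.IsElliptic] [hW : W.HasAdditiveReduction R]
    (hpm : W.HasPotentiallyMultiplicativeReduction R) (h2 : (2 : ResidueField R) ≠ 0)
    (h3 : (3 : ResidueField R) ≠ 0) :
    ∃ M : ℕ, 1 ≤ M ∧ VEq R (M + 6) W.Δ ∧ VEq R (-M) W.j ∧ VEq R 2 W.c₄ ∧ VEq R 3 W.c₆ := by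
  have hj := hpm.not_vge_j
  have hΔ0 : W.Δ ≠ 0 := W.isUnit_Δ.ne_zero
  have hc0 : W.c₄ ≠ 0 := by
    intro h
    have := Δ_mul_j W
    rw [h, zero_pow three_ne_zero, mul_eq_zero, or_iff_right hΔ0] at this
    exact hj (this ▸ vge_zero)
  obtain ⟨d, hd⟩ := exists_veq (R := R) hΔ0
  obtain ⟨p, hp⟩ := exists_veq (R := R) hc0
  have hp1 : 0 < p := by
    have : mulVal R W.c₄ < 1 := hW.additiveReduction
    rw [hp, ← WithZero.exp_zero, WithZero.exp_lt_exp] at this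
    omega
  have hjv : VEq R (3 * p - d) W.j :=
    VEq.of_mul (by rw [Δ_mul_j]; exact hp.pow 3 rfl) hd (by push_cast; omega)
  have hlt : 3 * p < d := by
    by_contra! h
    exact hj (hjv.vge (by omega))
  have hc6 : VEq R (3 * p) (W.c₆ ^ 2) := by
    rw [show W.c₆ ^ 2 = W.c₄ ^ 3 + -(1728 * W.Δ) by rw [W.c_relation]; ring]
    exact (hp.pow 3 (by norm_num)).add (((vge_ofNat 1728).mul (hd.vge le_rfl) (by omega)).neg)
  obtain ⟨q, hq⟩ := exists_veq (R := R) ((pow_ne_zero_iff two_ne_zero).1 hc6.ne_zero)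
  have hpq := (hq.pow 2 rfl).unique hc6
  have hp2 : p < 4 := by
    by_contra! h
    exact not_vge_c_of_isMinimal h2 h3 hΔ0 (hp.vge h) (hq.vge (by push_cast at hpq; omega))
  push_cast at hpq
  obtain rfl : p = 2 := by omega
  obtain rfl : q = 3 := by omega
  refine ⟨(d - 6).toNat, by omega, ?_, ?_, hp, hq⟩
  · rwa [show ((d - 6).toNat : ℤ) + 6 = d by omega]
  · rwa [show -((d - 6).toNat : ℤ) = 3 * 2 - d by omega]

/-- Moving the origin to the approximate node `x = (18 b₆ - b₂ b₄) / c₄` and completing the square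
gives `y² = x³ - c₆ / (4 c₄) x² - 36 Δ / c₄² x + c₆ Δ / c₄³`, which is of type `I_M^*`. -/
theorem hasKodairaTypeIStar_of_veq {M : ℕ} (hM : 1 ≤ M) (h2 : (2 : ResidueField R) ≠ 0)
    (h3 : (3 : ResidueField R) ≠ 0) (hΔ : VEq R (M + 6) W.Δ) (hc4 : VEq R 2 W.c₄)
    (hc6 : VEq R 3 W.c₆) : W.HasKodairaTypeIStar R M := by
  have two := veq_two (R := R) (K := K) h2
  have three := veq_three (R := R) (K := K) h3
  have four := veq_four (R := R) (K := K) h2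
  obtain ⟨ϖ, hϖ⟩ := IsDiscreteValuationRing.exists_irreducible R
  set C := W.squareChange 1 ((18 * W.b₆ - W.b₂ * W.b₄) / W.c₄) with hC
  have e : C • W = ⟨0, -W.c₆ / (4 * W.c₄), 0, -36 * W.Δ / W.c₄ ^ 2, W.c₆ * W.Δ / W.c₄ ^ 3⟩ := by
    have c0 := hc4.ne_zero
    have h8 := W.b_relation
    have hb8 : W.b₈ = (W.b₂ * W.b₆ - W.b₄ ^ 2) / 4 := by
      rw [← h8, mul_div_cancel_left₀ _ four.ne_zero]
    have := two.ne_zero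
    have := four.ne_zero
    rw [hC, squareChange_smul _ two.ne_zero, Units.val_one]
    ext <;> dsimp only
    · field_simp
      rw [c₄, c₆]
      ring
    · field_simp
      rw [Δ, hb8, c₄]
      field_simp
      ring
    · field_simp
      rw [Δ, hb8, c₆, c₄]
      field_simp
      ring
  have n36 : VEq R 0 (-36 : K) := by
    rw [show (-36 : K) = -(2 ^ 2 * 3 ^ 2) by norm_num]
    exact ((two.pow 2 rfl).mul (three.pow 2 rfl) (by norm_num)).neg
  have v2 : VEq R 1 (-W.c₆ / (4 * W.c₄)) := hc6.neg.div (four.mul hc4 rfl) (by norm_num)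
  have v4 : VEq R (M + 2) (-36 * W.Δ / W.c₄ ^ 2) :=
    (n36.mul hΔ rfl).div (hc4.pow 2 rfl) (by push_cast; omega)
  have v6 : VEq R (M + 3) (W.c₆ * W.Δ / W.c₄ ^ 3) :=
    (hc6.mul hΔ rfl).div (hc4.pow 3 rfl) (by push_cast; omega)
  obtain ⟨A₂, h₂⟩ := (v2.vge zero_le_one).exists_eq
  obtain ⟨A₄, h₄⟩ := (v4.vge (m := 0) (by omega)).exists_eq
  obtain ⟨A₆, h₆⟩ := (v6.vge (m := 0) (by omega)).exists_eq
  rw [← h₂, ← h₄, ← h₆] at e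
  rw [← h₂] at v2
  rw [← h₄] at v4
  rw [← h₆] at v6
  have hτ := veq_uniformizer (K := K) hϖ
  have hp (i : ℕ) := hτ.pow i (k := i) (by omega)
  have not_dvd {r : R} (hr : VEq R 0 (algebraMap R K r)) : ¬ ϖ ∣ r := fun h => by
    have := hr.le ((vge_one_dvd hϖ).2 h)
    omega
  have d2 : ϖ ∣ A₂ := (vge_one_dvd hϖ).1 (v2.vge le_rfl)
  refine ⟨⟨ϖ, hϖ, C, ⟨0, A₂, 0, A₄, A₆⟩, ?_, dvd_zero _, d2, fun h => ?_, ?_⟩⟩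
  · rw [e]
    ext <;> simp
  · have := v2.le (vge_of_dvd hϖ h (k := 2) (by norm_num))
    omega
  dsimp only
  obtain ⟨m, hm⟩ : ∃ m, M = 2 * m + 1 ∨ M = 2 * m + 2 := ⟨(M - 1) / 2, by omega⟩
  rcases hm with rfl | rfl
  · obtain ⟨b, rfl⟩ := (vge_pow_dvd (K := K) hϖ (i := 2 * m + 4)).1 (v6.vge (by push_cast; omega))
    refine .inl ⟨m, 0, b, rfl, by simp, (vge_pow_dvd (K := K) hϖ).1 (v4.vge (by push_cast; omega)),
      rfl, not_dvd ?_⟩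
    rw [map_mul, map_pow] at v6
    rw [zero_pow two_ne_zero, zero_add, map_mul, map_ofNat]
    exact four.mul (v6.of_mul (hp _) rfl) (by push_cast; omega)
  · obtain ⟨c, rfl⟩ := d2
    obtain ⟨a, rfl⟩ := (vge_pow_dvd (K := K) hϖ (i := m + 3)).1 (v4.vge (by push_cast; omega))
    obtain ⟨b, rfl⟩ := (vge_pow_dvd (K := K) hϖ (i := 2 * m + 5)).1 (v6.vge (by push_cast; omega))
    refine .inr ⟨m, c, a, b, rfl, dvd_zero _, rfl, rfl, rfl, not_dvd ?_⟩
    simp only [map_mul, map_pow] at v2 v4 v6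
    have va := v4.of_mul (hp _) rfl
    have vb := v6.of_mul (hp _) rfl
    have vc := v2.of_mul hτ rfl
    simp only [map_sub, map_mul, map_pow, map_ofNat]
    rw [sub_eq_add_neg, add_comm]
    exact (VEq.neg ((four.mul vc rfl).mul vb (by push_cast; omega))).add
      ((va.vge le_rfl).pow 2 (by push_cast; omega))

end Existence

end WeierstrassCurve

end

theorem mainTheorem4 {R : Type*} [CommRing R] [IsDomain R] [IsDiscreteValuationRing R]
    [IsAdicComplete (IsLocalRing.maximalIdeal R) R]
    [IsAlgClosed (IsLocalRing.ResidueField R)]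
    (h2 : (2 : IsLocalRing.ResidueField R) ≠ 0) (h3 : (3 : IsLocalRing.ResidueField R) ≠ 0)
    {K : Type u} [Field K] [DecidableEq K] [Algebra R K] [IsFractionRing R K]
    (W : WeierstrassCurve K) [W.IsElliptic] [W.HasAdditiveReduction R]
    (hpm : W.HasPotentiallyMultiplicativeReduction R) :
    -- the reduction type is `I_M^*` with `M = v(𝒟) - 6 = v(j⁻¹) ≥ 1`
    ∃ M : ℕ, 1 ≤ M ∧ W.HasKodairaTypeIStar R M ∧
      (M : ℤ) = WeierstrassCurve.ord R W.Δ - 6 ∧ (M : ℤ) = WeierstrassCurve.ord R W.j⁻¹ ∧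
    -- the canonical local height exists and is unique
    (∃! lam : {P : W.toAffine.Point // P ≠ 0} → ℝ, W.IsCanonicalLocalHeight R lam) ∧
    -- for every model at which Tate's algorithm stops, the components and the heights are:
    ∀ T : WeierstrassCurve.IStarModel R W M,
      -- every point hits exactly one of `0`, `α`, and `β` or `β'`
      (∀ P : W.toAffine.Point,
        (W.HitsZero R P ∨ T.HitsAlpha P ∨ T.HitsBeta P) ∧
        ¬ (W.HitsZero R P ∧ T.HitsAlpha P) ∧
        ¬ (W.HitsZero R P ∧ T.HitsBeta P) ∧
        ¬ (T.HitsAlpha P ∧ T.HitsBeta P)) ∧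
      ∀ lam : {P : W.toAffine.Point // P ≠ 0} → ℝ, W.IsCanonicalLocalHeight R lam →
        (∀ (ν : ℕ) (P : {P : W.toAffine.Point // P ≠ 0}),
          P.1 ∈ W.formalFiltration R ν \ W.formalFiltration R (ν + 1) →
          lam P = (WeierstrassCurve.ord R W.Δ : ℝ) / 12 + ν ∧
          lam P = (WeierstrassCurve.ord R W.j⁻¹ : ℝ) / 12 + 1 / 2 + ν) ∧
        (∀ P : {P : W.toAffine.Point // P ≠ 0}, T.HitsAlpha P.1 →
          lam P = (WeierstrassCurve.ord R W.j⁻¹ : ℝ) / 12 ∧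
          lam P = 1 / 2 * WeierstrassCurve.periodicB₂ 0 * (WeierstrassCurve.ord R W.j⁻¹ : ℝ)) ∧
        (∀ P : {P : W.toAffine.Point // P ≠ 0}, T.HitsBeta P.1 →
          lam P = -(WeierstrassCurve.ord R W.j⁻¹ : ℝ) / 24 ∧
          lam P = 1 / 2 * WeierstrassCurve.periodicB₂ (1 / 2) *
            (WeierstrassCurve.ord R W.j⁻¹ : ℝ)) := by
  obtain ⟨M, hM, hΔ, hj, hc4, hc6⟩ :=
    WeierstrassCurve.exists_valuations_of_additive (R := R) hpm h2 h3
  have oj : WeierstrassCurve.ord R W.j⁻¹ = M := (hj.inv (neg_neg _).symm).ord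
  have oΔ : WeierstrassCurve.ord R W.Δ = M + 6 := hΔ.ord
  have hT := WeierstrassCurve.hasKodairaTypeIStar_of_veq hM h2 h3 hΔ hc4 hc6
  have key (T : WeierstrassCurve.IStarModel R W M) :
      WeierstrassCurve.VEq R 0 (T.C.u : K) ∧ WeierstrassCurve.VGe R 0 T.C.r :=
    ⟨T.veq_u h2 hM hΔ, (T.vge_rst h2 h3 inferInstance (T.veq_u h2 hM hΔ)).1⟩
  refine ⟨M, hM, hT, by omega, oj.symm, ?_, fun T => ⟨?_, fun lam hlam => ?_⟩⟩
  · obtain ⟨T⟩ := hT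
    exact ⟨_, T.isCanonicalLocalHeight_height (key T).1 (key T).2 h2 hM,
      fun lam hlam => hlam.unique h2 (T.isCanonicalLocalHeight_height (key T).1 (key T).2 h2 hM)⟩
  · exact fun P => T.hits_exactly_one (key T).1 (key T).2 h2 hM P
  · obtain ⟨hu, hr⟩ := key T
    obtain rfl := hlam.unique h2 (T.isCanonicalLocalHeight_height hu hr h2 hM)
    rw [oj, oΔ]
    push_cast
    refine ⟨fun ν P hP => ?_, fun P hP => ?_, fun P hP => ?_⟩
    · rw [T.height_of_mem_formalFiltration hu hr h2 hM ν P.2 hP]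
      constructor <;> ring
    · rw [T.height_of_hitsAlpha hu h2 hM hP, WeierstrassCurve.periodicB₂, Int.fract_zero]
      constructor <;> ring
    · rw [T.height_of_hitsBeta hu h2 hM hP, WeierstrassCurve.periodicB₂,
        Int.fract_eq_self.2 (by norm_num)]
      constructor <;> ring
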